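/- \textbf{Conventions.} All local groups are finitely generated. A complex of groups $(\mathcal G,\mathcal Y)$ over a simplicial complex $\mathcal Y$ consists of a group $G_\sigma$ for every simplex $\sigma$, a monomorphism $\psi_{\tau\sigma}:G_\sigma\to G_\tau$ for all simplices $\tau\subsetneq\sigma$, and a twisting element $g_{\rho\tau\sigma}\in G_\rho$ for all $\rho\subsetneq\tau\subsetneq\sigma$, such that $g_{\rho\tau\sigma}\,\psi_{\rho\sigma}(x)\,g_{\rho\tau\sigma}^{-1}=\psi_{\rho\tau}(\psi_{\tau\sigma}(x))$ and $\psi_{\pi\rho}(g_{\rho\tau\sigma})\,g_{\pi\rho\sigma}=g_{\pi\rho\tau}\,g_{\pi\tau\sigma}$. It is developable if it has a morphism to some group that is injective on all local groups. Its fundamental group $\pi_1(\mathcal G,\sigma_0)$ is the group of the elements represented by $\mathcal G$-loops at $\sigma_0$ in the universal group generated by the groups $G_\sigma$ and symbols $e_{\tau\sigma}$ ($\tau\subsetneq\sigma$) with relations $e_{\rho\tau}e_{\tau\sigma}=g_{\rho\tau\sigma}e_{\rho\sigma}$ and $e_{\tau\sigma}xe_{\tau\sigma}^{-1}=\psi_{\tau\sigma}(x)$.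 A developable complex of groups over a finite connected simplicial complex satisfies the \emph{qi condition} if every $\psi_{\tau\sigma}$ has image of finite index. A complex of groups $(\mathcal G,\mathcal Y)$, with $\mathcal Y$ finite and connected, is \emph{based on a graph} $Y$ (a finite connected simplicial complex with $\dim Y\le 1$) if there is a simplicial map $p:\mathcal Y\to Y$ such that for each vertex $y$ of $Y$ the preimage $\mathcal Y_y=p^{-1}(y)$ is a connected subcomplex and the restriction of $\mathcal G$ to $\mathcal Y_y$ is developable, and $p$ induces a bijection between the edges of $\mathcal Y$ that are mapped onto edges of $Y$ and the edges of $Y$; it is based on $Y$ \emph{with the qi condition} if moreover each of these restrictions satisfies the qi condition. For a vertex $a$ of $\mathcal Y$ consider the equivalence relation on the edges at $a$ generated by lying in a common simplex. A \emph{cluster} at $a$ is an equivalence class $c$ with more than one element; let $S_c$ be the subcomplex spanned by the simplices that contain an edge of $c$. A developable $(\mathcal G,\mathcal Y)$ over a finite connected $\mathcal Y$ satisfies the \emph{weak qi condition} if for every vertex $a$ and every cluster $c$ at $a$: (1) there is a subgroup $H_{a,c}\le G_a$ containing the images of $G_e$, $e\in c$, each with finite index, and all twisting elements $g_{a\tau\sigma}\in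 G_a$ with $\sigma$ in $S_c$; (2) $\psi_{\tau\sigma}$ has image of finite index for all $\tau\subsetneq\sigma$ in $S_c$ with $\dim\tau\ge1$. Given such subgroups $H_{a,c}$, the \emph{surgery} at all vertices is the following complex of groups $(\mathcal G',\mathcal Y')$. The vertices of $\mathcal Y'$ are the vertices $a$ of $\mathcal Y$ and, for every cluster $c$ at $a$, two new vertices $m_{a,c}$ and $a_c$. The simplices of $\mathcal Y'$ are the vertices $a$, the edges of $\mathcal Y$ contained in no bigger simplex, the edges $[a,m_{a,c}]$ and $[m_{a,c},a_c]$, the simplices $\sigma$ of $\mathcal Y$ of dimension at least $2$ with each vertex $a\in\sigma$ replaced by $a_c$, where $c$ is the cluster at $a$ containing the edges of $\sigma$ at $a$, and all faces of these. Let $f:\mathcal Y'\to\mathcal Y$ be the map that collapses the new edges. Then $G'_s=H_{a,c}\le G_a$ for $s\in\{\{m_{a,c}\},\{a_c\},[a,m_{a,c}],[m_{a,c},a_c]\}$ and $G'_s=G_{f(s)}$ for the other simplices $s$; the monomorphisms and twisting elements are the restrictions of those of $\mathcal G$, and are inclusions and trivial elements along the new edges. \textbf{Surgery Lemma.} Let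 $\mathcal Y$ be a finite connected simplicial complex and $(\mathcal G,\mathcal Y)$ a developable complex of (finitely generated) groups satisfying the weak qi condition. Then there are subgroups $H_{a,c}$ as in (1), a finite graph $Y'$ (a finite connected simplicial complex of dimension at most $1$) and a map $p':\mathcal Y'\to Y'$ such that the complex of groups $(\mathcal G',\mathcal Y')$ obtained from $(\mathcal G,\mathcal Y)$ by surgery at all vertices is developable, has finitely generated local groups, is based on the graph $Y'$ with the qi condition through $p'$, and has fundamental group isomorphic to that of $(\mathcal G,\mathcal Y)$ (for any choice of base simplices). -/

import Mathlib

universe u v w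

/-! ## Complexes of groups -/

/-- A complex of groups over (the small category without loops attached to) a poset `P`.
For a simplicial complex, `P` is its set of simplices ordered by inclusion; each pair `τ < σ` is an
edge with initial vertex `σ` and terminal vertex `τ`, and the local homomorphism goes from the
group of the larger simplex `σ` to the group of its face `τ`.
`twist h₁ h₂` is the twisting element `g_{a,b}` of the composable pair `a : τ → ρ`, `b : σ → τ`.
The data are written for `τ ≤ σ` and are normalized on the units of the category
(identity homomorphisms and trivial twisting elements), so they amount exactly to data on the
strict inclusions. -/
structure ComplexOfGroups (P : Type u) [PartialOrder P] where
  /-- the local groups -/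
  G : P → Type v
  [grp : ∀ σ, Group (G σ)]
  /-- the local homomorphisms -/
  ψ : ∀ {τ σ : P}, τ ≤ σ → G σ →* G τ
  /-- the twisting elements -/
  twist : ∀ {ρ τ σ : P}, ρ ≤ τ → τ ≤ σ → G ρ
  ψ_injective : ∀ {τ σ : P} (h : τ ≤ σ), Function.Injective (ψ h)
  ψ_refl : ∀ (σ : P) (x : G σ), ψ (le_refl σ) x = x
  twist_refl_left : ∀ {τ σ : P} (h : τ ≤ σ), twist (le_refl τ) h = 1
  twist_refl_right : ∀ {τ σ : P} (h : τ ≤ σ), twist h (le_refl σ) = 1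
  ψ_comp : ∀ {ρ τ σ : P} (h₁ : ρ ≤ τ) (h₂ : τ ≤ σ) (x : G σ),
    twist h₁ h₂ * ψ (h₁.trans h₂) x * (twist h₁ h₂)⁻¹ = ψ h₁ (ψ h₂ x)
  cocycle : ∀ {π ρ τ σ : P} (h₁ : π ≤ ρ) (h₂ : ρ ≤ τ) (h₃ : τ ≤ σ),
    ψ h₁ (twist h₂ h₃) * twist h₁ (h₂.trans h₃) = twist h₁ h₂ * twist (h₁.trans h₂) h₃

namespace ComplexOfGroups

attribute [instance] ComplexOfGroups.grp

section Basic

variable {P : Type u} [PartialOrder P] (𝒢 : ComplexOfGroups.{u, v} P)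

/-- A morphism from a complex of groups to a group `Γ`: homomorphisms on the local groups, together
with an element of `Γ` for every edge, compatible with the local homomorphisms and the twisting
elements. -/
structure MorphismTo (Γ : Type w) [Group Γ] where
  toHom : ∀ σ : P, 𝒢.G σ →* Γ
  edge : ∀ {τ σ : P}, τ ≤ σ → Γ
  conj : ∀ {τ σ : P} (h : τ ≤ σ) (x : 𝒢.G σ),
    edge h * toHom σ x * (edge h)⁻¹ = toHom τ (𝒢.ψ h x)
  comp : ∀ {ρ τ σ : P} (h₁ : ρ ≤ τ) (h₂ : τ ≤ σ),
    toHom ρ (𝒢.twist h₁ h₂) * edge (h₁.trans h₂) = edge h₁ * edge h₂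

/-- A complex of groups is developable if it has a morphism to some group that is injective on the
local groups. -/
def Developable : Prop :=
  ∃ (Γ : Type (max u v)) (_ : Group Γ) (φ : 𝒢.MorphismTo Γ),
    ∀ σ, Function.Injective (φ.toHom σ)

/-- Generators of the universal group: the elements of the local groups, and the edges. -/
inductive Gen : Type (max u v)
  | loc (σ : P) (x : 𝒢.G σ) : Gen
  | edge {τ σ : P} (h : τ ≤ σ) : Gen

/-- Relators of the universal group: those of the local groups,
`a⁺ b⁺ = g_{a,b} (ab)⁺`, and `a⁺ x (a⁺)⁻¹ = ψ_a x`. -/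
inductive Relator : FreeGroup 𝒢.Gen → Prop
  | mul (σ : P) (x y : 𝒢.G σ) :
      Relator (FreeGroup.of (.loc σ x) * FreeGroup.of (.loc σ y) *
        (FreeGroup.of (.loc σ (x * y)))⁻¹)
  | comp {ρ τ σ : P} (h₁ : ρ ≤ τ) (h₂ : τ ≤ σ) :
      Relator (FreeGroup.of (.edge h₁) * FreeGroup.of (.edge h₂) *
        (FreeGroup.of (.loc ρ (𝒢.twist h₁ h₂)) * FreeGroup.of (.edge (h₁.trans h₂)))⁻¹)
  | conj {τ σ : P} (h : τ ≤ σ) (x : 𝒢.G σ) :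
      Relator (FreeGroup.of (.edge h) * FreeGroup.of (.loc σ x) * (FreeGroup.of (.edge h))⁻¹ *
        (FreeGroup.of (.loc τ (𝒢.ψ h x)))⁻¹)

/-- The universal group `FG(𝒢)`. -/
abbrev UniversalGroup : Type (max u v) := PresentedGroup {r | 𝒢.Relator r}

/-- `𝒢.IsPath σ τ x` says that `x` is represented by a `𝒢`-path from `σ` to `τ`, i.e. by a word
`g₀ e₁ g₁ ⋯ eₖ gₖ` where `e₁, …, eₖ` is an edge path from `σ` to `τ` and `gᵢ` lies in the local
group at the corresponding vertex of that edge path. The generator `a⁺` of an edge `τ ≤ σ` leads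
from `τ` to `σ`. -/
inductive IsPath : P → P → 𝒢.UniversalGroup → Prop
  | loc (σ : P) (x : 𝒢.G σ) : IsPath σ σ (PresentedGroup.of (.loc σ x))
  | edge {τ σ : P} (h : τ ≤ σ) : IsPath τ σ (PresentedGroup.of (.edge h))
  | inv {σ τ : P} {x : 𝒢.UniversalGroup} : IsPath σ τ x → IsPath τ σ x⁻¹
  | mul {σ τ ρ : P} {x y : 𝒢.UniversalGroup} :
      IsPath σ τ x → IsPath τ ρ y → IsPath σ ρ (x * y)

/-- The fundamental group `π₁(𝒢, σ₀)`: the elements of the universal group that are represented by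
`𝒢`-loops at `σ₀`. -/
def π₁ (σ₀ : P) : Subgroup 𝒢.UniversalGroup where
  carrier := {x | 𝒢.IsPath σ₀ σ₀ x}
  mul_mem' := fun hx hy => IsPath.mul hx hy
  one_mem' := by
    have h := (IsPath.loc (𝒢 := 𝒢) σ₀ 1).mul (IsPath.loc σ₀ 1).inv
    rwa [mul_inv_cancel] at h
  inv_mem' := fun hx => IsPath.inv hx

/-- The pullback of a complex of groups along a monotone map. -/
def pullback {Q : Type u} [PartialOrder Q] (f : Q → P) (hf : Monotone f) :
    ComplexOfGroups.{u, v} Q where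
  G σ := 𝒢.G (f σ)
  ψ h := 𝒢.ψ (hf h)
  twist h₁ h₂ := 𝒢.twist (hf h₁) (hf h₂)
  ψ_injective h := 𝒢.ψ_injective (hf h)
  ψ_refl σ x := 𝒢.ψ_refl (f σ) x
  twist_refl_left h := 𝒢.twist_refl_left (hf h)
  twist_refl_right h := 𝒢.twist_refl_right (hf h)
  ψ_comp h₁ h₂ x := 𝒢.ψ_comp (hf h₁) (hf h₂) x
  cocycle h₁ h₂ h₃ := 𝒢.cocycle (hf h₁) (hf h₂) (hf h₃)

/-- The complex of groups formed by subgroups of the local groups that are respected by the local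
homomorphisms and contain the twisting elements. -/
def sub (L : ∀ σ, Subgroup (𝒢.G σ))
    (hψ : ∀ {τ σ : P} (h : τ ≤ σ) (x : 𝒢.G σ), x ∈ L σ → 𝒢.ψ h x ∈ L τ)
    (ht : ∀ {ρ τ σ : P} (h₁ : ρ ≤ τ) (h₂ : τ ≤ σ), 𝒢.twist h₁ h₂ ∈ L ρ) :
    ComplexOfGroups.{u, v} P where
  G σ := L σ
  ψ h := ((𝒢.ψ h).comp (L _).subtype).codRestrict (L _) fun x => hψ h x x.2
  twist h₁ h₂ := ⟨𝒢.twist h₁ h₂, ht h₁ h₂⟩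
  ψ_injective h _ _ hxy := Subtype.ext (𝒢.ψ_injective h (congrArg Subtype.val hxy))
  ψ_refl σ x := Subtype.ext (𝒢.ψ_refl σ x)
  twist_refl_left h := Subtype.ext (𝒢.twist_refl_left h)
  twist_refl_right h := Subtype.ext (𝒢.twist_refl_right h)
  ψ_comp h₁ h₂ x := Subtype.ext (𝒢.ψ_comp h₁ h₂ x)
  cocycle h₁ h₂ h₃ := Subtype.ext (𝒢.cocycle h₁ h₂ h₃)

end Basic

end ComplexOfGroups

/-! ## Simplicial complexes -/

namespace PreAbstractSimplicialComplex

variable {V : Type u} {W : Type w}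

theorem mem_of_subset (K : PreAbstractSimplicialComplex V) {s t : Finset V} (hs : s ∈ K)
    (hts : t ⊆ s) (ht : t.Nonempty) : t ∈ K :=
  (K.isRelLowerSet_faces hs).2 hts ht

/-- The complex has finitely many simplices. -/
def IsFinite (K : PreAbstractSimplicialComplex V) : Prop := K.faces.Finite

/-- The complex is nonempty and any two vertices are joined by an edge path. -/
def IsConnected (K : PreAbstractSimplicialComplex V) : Prop :=
  K.faces.Nonempty ∧ ∀ a b, {a} ∈ K → {b} ∈ K →
    Relation.ReflTransGen (fun x y => ∃ s ∈ K, x ∈ s ∧ y ∈ s) a b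

/-- `p` is a simplicial map from `K` to `Y`. -/
def IsSimplicial (K : PreAbstractSimplicialComplex V) (Y : PreAbstractSimplicialComplex W)
    (p : V → W) : Prop :=
  ∀ s ∈ K, ∃ t ∈ Y, (t : Set W) = p '' s

/-- The subcomplex of the simplices that a map `p` sends to the vertex `y`. -/
def fiber (K : PreAbstractSimplicialComplex V) (p : V → W) (y : W) :
    PreAbstractSimplicialComplex V where
  faces := {s | s ∈ K ∧ ∀ x ∈ s, p x = y}
  isRelLowerSet_faces := fun _ hs =>
    ⟨(K.isRelLowerSet_faces hs.1).1, fun _ hts ht =>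
      ⟨K.mem_of_subset hs.1 hts ht, fun x hx => hs.2 x (hts hx)⟩⟩

theorem fiber_le (K : PreAbstractSimplicialComplex V) (p : V → W) (y : W) : K.fiber p y ≤ K :=
  fun _ hs => hs.1

end PreAbstractSimplicialComplex

namespace ComplexOfGroups

variable {V : Type u} {W : Type w} {K : PreAbstractSimplicialComplex V}

/-- The restriction of a complex of groups to a subcomplex. -/
def restrict (𝒢 : ComplexOfGroups.{u, v} K) (L : PreAbstractSimplicialComplex V) (h : L ≤ K) :
    ComplexOfGroups.{u, v} L :=
  𝒢.pullback (fun s : L => (⟨s.1, h s.2⟩ : K)) fun _ _ hst => hst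

/-- The qi condition: a developable complex of groups over a finite connected simplicial complex
all of whose local homomorphisms have images of finite index. -/
structure QICondition (𝒢 : ComplexOfGroups.{u, v} K) : Prop where
  isFinite : K.IsFinite
  isConnected : K.IsConnected
  developable : 𝒢.Developable
  finiteIndex : ∀ {τ σ : K} (h : τ < σ), (𝒢.ψ h.le).range.FiniteIndex

/-- `𝒢` is a complex of groups based on the graph `Y`, through the map `p`. -/
structure IsBasedOnGraph (𝒢 : ComplexOfGroups.{u, v} K) (Y : PreAbstractSimplicialComplex W)
    (p : V → W) : Prop where
  isFinite_total : K.IsFinite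
  isConnected_total : K.IsConnected
  isFinite_base : Y.IsFinite
  isConnected_base : Y.IsConnected
  dim_base : ∀ e ∈ Y, e.card ≤ 2
  isSimplicial : K.IsSimplicial Y p
  fiber_connected : ∀ y, {y} ∈ Y → (K.fiber p y).IsConnected
  fiber_developable : ∀ y, {y} ∈ Y → (𝒢.restrict (K.fiber p y) (K.fiber_le p y)).Developable
  /-- `p` induces a bijection between the edges of `K` joining `p⁻¹(y)` and `p⁻¹(z)` for some edge
  `[y, z]` of `Y`, and the edges of `Y`. -/
  edge_bijection : ∀ e ∈ Y, e.card = 2 →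
    ∃! s : Finset V, s ∈ K ∧ s.card = 2 ∧ p '' (s : Set V) = (e : Set W)

/-- `𝒢` is a complex of groups based on the graph `Y`, with the qi condition. -/
structure IsBasedOnGraphQI (𝒢 : ComplexOfGroups.{u, v} K) (Y : PreAbstractSimplicialComplex W)
    (p : V → W) : Prop extends 𝒢.IsBasedOnGraph Y p where
  fiber_qi : ∀ y, {y} ∈ Y → (𝒢.restrict (K.fiber p y) (K.fiber_le p y)).QICondition

end ComplexOfGroups

/-! ## Clusters at a vertex and the weak qi condition -/

namespace PreAbstractSimplicialComplex

variable {V : Type u} (K : PreAbstractSimplicialComplex V)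

/-- `e` is an edge (a `1`-simplex) of `K` containing the vertex `a`. -/
def IsEdgeAt (a : V) (e : Finset V) : Prop := e ∈ K ∧ e.card = 2 ∧ a ∈ e

/-- Two edges at `a` lie in a common simplex. -/
def EdgeAdj (a : V) (e e' : Finset V) : Prop :=
  K.IsEdgeAt a e ∧ K.IsEdgeAt a e' ∧ ∃ τ ∈ K, e ⊆ τ ∧ e' ⊆ τ

/-- The equivalence class of the edge `e` at `a`, for the relation generated by lying in a common
simplex. -/
def edgeClass (a : V) (e : Finset V) : Set (Finset V) :=
  {e' | Relation.ReflTransGen (K.EdgeAdj a) e e'}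

/-- `c` is an equivalence class, with more than one element, of edges at `a`. -/
def IsCluster (a : V) (c : Set (Finset V)) : Prop :=
  ∃ e, K.IsEdgeAt a e ∧ c = K.edgeClass a e ∧ c.Nontrivial

/-- The subcomplex spanned by the simplices that contain an edge of the class `c`. -/
def clusterFaces (c : Set (Finset V)) : Set (Finset V) :=
  {s | s ∈ K ∧ ∃ σ ∈ K, s ⊆ σ ∧ ∃ e ∈ c, e ⊆ σ}

/-- The class of the edges at `a` contained in the simplex `σ`. -/
def classAt (σ : Finset V) (a : V) : Set (Finset V) :=
  {e' | ∃ e, K.IsEdgeAt a e ∧ e ⊆ σ ∧ e' ∈ K.edgeClass a e}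

end PreAbstractSimplicialComplex

namespace ComplexOfGroups

variable {V : Type u} {K : PreAbstractSimplicialComplex V}

/-- The conditions on a subgroup `H` of the local group at the vertex `ρ` attached to the cluster
`c` of edges at `ρ`: it contains the images of the groups of the edges in `c`, each with finite
index, and the twisting elements in the local group at `ρ` of the pairs of composable edges in the
subcomplex spanned by `c`. -/
structure IsClusterSubgroup (𝒢 : ComplexOfGroups.{u, v} K) (ρ : K) (c : Set (Finset V))
    (H : Subgroup (𝒢.G ρ)) : Prop where
  range_le : ∀ {e : K} (h : ρ ≤ e), e.1 ∈ c → (𝒢.ψ h).range ≤ H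
  twist_mem : ∀ {τ σ : K} (h₁ : ρ < τ) (h₂ : τ < σ), σ.1 ∈ K.clusterFaces c →
    𝒢.twist h₁.le h₂.le ∈ H
  finiteIndex : ∀ {e : K} (h : ρ ≤ e), e.1 ∈ c → ((𝒢.ψ h).range.subgroupOf H).FiniteIndex

/-- The weak qi condition (for a developable complex of groups over a finite connected complex). -/
structure WeakQICondition (𝒢 : ComplexOfGroups.{u, v} K) : Prop where
  exists_subgroup : ∀ (a : V) (ha : {a} ∈ K) (c : Set (Finset V)), K.IsCluster a c →
    ∃ H : Subgroup (𝒢.G ⟨{a}, ha⟩), 𝒢.IsClusterSubgroup ⟨{a}, ha⟩ c H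
  finiteIndex : ∀ (a : V) (c : Set (Finset V)), K.IsCluster a c →
    ∀ {τ σ : K} (h : τ < σ), 2 ≤ τ.1.card → σ.1 ∈ K.clusterFaces c →
      (𝒢.ψ h.le).range.FiniteIndex

/-- A choice of cluster subgroups. Only the values of `H` at pairs of a vertex of `K` and a cluster
at that vertex matter. -/
structure SurgeryData (𝒢 : ComplexOfGroups.{u, v} K) where
  H : ∀ ρ : K, Set (Finset V) → Subgroup (𝒢.G ρ)
  spec : ∀ (a : V) (ha : {a} ∈ K) (c : Set (Finset V)), K.IsCluster a c →
    𝒢.IsClusterSubgroup ⟨{a}, ha⟩ c (H ⟨{a}, ha⟩ c)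

end ComplexOfGroups

/-! ## The surgery -/

/-- Vertices of the complex obtained by surgery: for every vertex `a` the vertex `base a`, and for
every cluster `c` at `a` a vertex `copy a c`, which replaces `a` in the simplices of the cluster,
together with the midpoint `mid a c` of a segment that joins `base a` to `copy a c`. -/
inductive SurgeryVertex (V : Type u) : Type u
  | base (a : V) : SurgeryVertex V
  | mid (a : V) (c : Set (Finset V)) : SurgeryVertex V
  | copy (a : V) (c : Set (Finset V)) : SurgeryVertex V

namespace SurgeryVertex

variable {V : Type u}

/-- The map that collapses the new segments. -/
def collapse : SurgeryVertex V → V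
  | base a => a
  | mid a _ => a
  | copy a _ => a

/-- The new vertex `x` lies on the part of its segment that belongs to the cluster `c`. -/
def HasLabel : SurgeryVertex V → Set (Finset V) → Prop
  | base _, _ => False
  | mid _ c', c => c' = c
  | copy _ c', c => c' = c

end SurgeryVertex

namespace PreAbstractSimplicialComplex

open SurgeryVertex

variable {V : Type u} (K : PreAbstractSimplicialComplex V)

open scoped Classical in
/-- Simplices that generate the complex obtained by surgery: the vertices `base a`, the edges of `K`
that are contained in no bigger simplex, the two halves of the segment from `base a` to `copy a c`
for every cluster `c` at `a`, and the simplices of `K` of dimension at least two, each of whose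
vertices is replaced by its copy for the cluster that contains the simplex. -/
inductive SurgeryGenerator : Finset (SurgeryVertex V) → Prop
  | vertex (a : V) : {a} ∈ K → SurgeryGenerator {base a}
  | edge (e : Finset V) : e ∈ K → e.card = 2 → (∀ τ ∈ K, e ⊆ τ → τ = e) →
      SurgeryGenerator (e.image base)
  | inner (a : V) (c : Set (Finset V)) : {a} ∈ K → K.IsCluster a c →
      SurgeryGenerator {base a, mid a c}
  | outer (a : V) (c : Set (Finset V)) : {a} ∈ K → K.IsCluster a c →
      SurgeryGenerator {mid a c, copy a c}
  | thick (σ : Finset V) : σ ∈ K → 3 ≤ σ.card →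
      SurgeryGenerator (σ.image fun a => copy a (K.classAt σ a))

/-- The simplicial complex obtained from `K` by surgery at all the vertices. -/
def surgery : PreAbstractSimplicialComplex (SurgeryVertex V) where
  faces := {s | s.Nonempty ∧ ∃ t, K.SurgeryGenerator t ∧ s ⊆ t}
  isRelLowerSet_faces := fun _ hs =>
    ⟨hs.1, fun _ hts ht => ⟨ht, hs.2.imp fun _ h => ⟨h.1, hts.trans h.2⟩⟩⟩

open scoped Classical in
theorem image_collapse_mem {s : Finset (SurgeryVertex V)} (hs : s ∈ K.surgery) :
    s.image collapse ∈ K := by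
  obtain ⟨hne, t, ht, hst⟩ := hs
  have key : t.image collapse ∈ K := by
    cases ht with
    | vertex a ha => simpa [collapse] using ha
    | edge e he _ _ =>
      rw [Finset.image_image]
      have : (collapse ∘ base : V → V) = id := rfl
      rwa [this, Finset.image_id]
    | inner a c ha _ => simpa [collapse] using ha
    | outer a c ha _ => simpa [collapse] using ha
    | thick σ hσ _ =>
      rw [Finset.image_image]
      have : (collapse ∘ fun a => copy a (K.classAt σ a) : V → V) = id := rfl
      rwa [this, Finset.image_id]
  exact K.mem_of_subset key (Finset.image_subset_image hst) (hne.image _)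

open scoped Classical in
/-- The map on simplices induced by the collapse of the new segments. -/
noncomputable def collapseFace (s : K.surgery) : K := ⟨s.1.image collapse, K.image_collapse_mem s.2⟩

theorem collapseFace_mono : Monotone K.collapseFace := by
  classical
  exact fun _ _ h => Finset.image_subset_image h

theorem isEdgeAt_pair {σ : Finset V} (hσ : σ ∈ K) {a b : V} (ha : a ∈ σ) (hb : b ∈ σ)
    (hab : a ≠ b) : ∃ e, K.IsEdgeAt a e ∧ b ∈ e ∧ e ⊆ σ ∧ ∀ x ∈ e, x = a ∨ x = b := by
  classical
  have hsub : ({a, b} : Finset V) ⊆ σ := by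
    intro x hx
    simp only [Finset.mem_insert, Finset.mem_singleton] at hx
    rcases hx with rfl | rfl <;> assumption
  exact ⟨{a, b}, ⟨K.mem_of_subset hσ hsub ⟨a, by simp⟩, Finset.card_pair hab, by simp⟩,
    by simp, hsub, fun x hx => by simpa using hx⟩

theorem isCluster_classAt {σ : Finset V} (hσ : σ ∈ K) (hcard : 3 ≤ σ.card) {a : V} (ha : a ∈ σ) :
    K.IsCluster a (K.classAt σ a) := by
  classical
  have h1 : 1 < (σ.erase a).card := by rw [Finset.card_erase_of_mem ha]; omega
  obtain ⟨b, hb, d, hd, hbd⟩ := Finset.one_lt_card.1 h1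
  rw [Finset.mem_erase] at hb hd
  obtain ⟨e, he, hbe, heσ, _⟩ := K.isEdgeAt_pair hσ ha hb.2 hb.1.symm
  obtain ⟨e', he', hde', heσ', hmem⟩ := K.isEdgeAt_pair hσ ha hd.2 hd.1.symm
  have heq : K.classAt σ a = K.edgeClass a e := by
    ext f
    constructor
    · rintro ⟨g, hg, hgσ, hf⟩
      exact Relation.ReflTransGen.head ⟨he, hg, σ, hσ, heσ, hgσ⟩ hf
    · exact fun hf => ⟨e, he, heσ, hf⟩
  refine ⟨e, he, heq, e, ⟨e, he, heσ, .refl⟩, e', ⟨e', he', heσ', .refl⟩, ?_⟩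
  rintro rfl
  rcases hmem b hbe with h | h
  · exact hb.1 h
  · exact hbd h

/-- A vertex with label `c` of a simplex that is not collapsed to a vertex comes from a simplex of
dimension at least two in the cluster `c`. -/
theorem exists_thick {s : K.surgery} {x : SurgeryVertex V} {c : Set (Finset V)} (hx : x ∈ s.1)
    (hl : x.HasLabel c) (hs : (K.collapseFace s).1 ≠ {x.collapse}) :
    ∃ σ ∈ K, 3 ≤ σ.card ∧ (K.collapseFace s).1 ⊆ σ ∧ x.collapse ∈ σ ∧
      c = K.classAt σ x.collapse := by
  classical
  obtain ⟨s, hne, t, ht, hst⟩ := s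
  have hsmall : ∀ a : V, (∀ y ∈ t, y.collapse = a) → False := by
    intro a hy
    apply hs
    ext z
    simp only [collapseFace, Finset.mem_image, Finset.mem_singleton]
    constructor
    · rintro ⟨y, hys, rfl⟩
      rw [hy y (hst hys), hy x (hst hx)]
    · rintro rfl
      exact ⟨x, hx, rfl⟩
  cases ht with
  | vertex a ha => exact (hsmall a (by simp [collapse])).elim
  | edge e _ _ _ =>
    obtain ⟨a, _, rfl⟩ := Finset.mem_image.1 (hst hx)
    exact hl.elim
  | inner a c ha _ => exact (hsmall a (by simp [collapse])).elim
  | outer a c ha _ => exact (hsmall a (by simp [collapse])).elim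
  | thick σ hσ hcard =>
    obtain ⟨a, ha, rfl⟩ := Finset.mem_image.1 (hst hx)
    refine ⟨σ, hσ, hcard, ?_, ha, (show K.classAt σ a = c from hl).symm⟩
    intro z hz
    obtain ⟨y, hys, rfl⟩ := Finset.mem_image.1 hz
    obtain ⟨b, hb, rfl⟩ := Finset.mem_image.1 (hst hys)
    exact hb

end PreAbstractSimplicialComplex

namespace ComplexOfGroups

open PreAbstractSimplicialComplex

variable {V : Type u} {K : PreAbstractSimplicialComplex V} {𝒢 : ComplexOfGroups.{u, v} K}

namespace SurgeryData

variable (D : 𝒢.SurgeryData)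

/-- The local groups of the complex of groups obtained by surgery, as subgroups of the local groups
of `𝒢`: the cluster subgroup for `c` at `a` on the simplices that are collapsed to the vertex `a`
and contain `mid a c` or `copy a c`, and the full local group on the other simplices. -/
noncomputable def localGroup (s : K.surgery) : Subgroup (𝒢.G (K.collapseFace s)) :=
  ⨅ (x : SurgeryVertex V) (c : Set (Finset V)) (_ : x ∈ s.1) (_ : x.HasLabel c)
    (_ : (K.collapseFace s).1 = {x.collapse}), D.H (K.collapseFace s) c

theorem mem_localGroup {s : K.surgery} {g : 𝒢.G (K.collapseFace s)} :
    g ∈ D.localGroup s ↔ ∀ (x : SurgeryVertex V) (c : Set (Finset V)), x ∈ s.1 → x.HasLabel c →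
      (K.collapseFace s).1 = {x.collapse} → g ∈ D.H (K.collapseFace s) c := by
  simp only [localGroup, Subgroup.mem_iInf]

theorem ψ_mem_H {ρ σ : K} (h : ρ ≤ σ) {a : V} (hρ : ρ.1 = {a}) {σ' : Finset V} (hσ' : σ' ∈ K)
    (hcard : 3 ≤ σ'.card) (hsub : σ.1 ⊆ σ') (hne : σ.1 ≠ {a}) (g : 𝒢.G σ) :
    𝒢.ψ h g ∈ D.H ρ (K.classAt σ' a) := by
  obtain ⟨ρ, hρK⟩ := ρ
  obtain rfl : ρ = {a} := hρ
  have haσ : a ∈ σ.1 := h (Finset.mem_singleton_self a)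
  have hspec := D.spec a hρK _ (K.isCluster_classAt hσ' hcard (hsub haσ))
  obtain ⟨b, hb, hba⟩ : ∃ b ∈ σ.1, b ≠ a := by
    by_contra! hcon
    exact hne (Finset.eq_singleton_iff_unique_mem.2 ⟨haσ, hcon⟩)
  obtain ⟨e, he, -, heσ, -⟩ := K.isEdgeAt_pair σ.2 haσ hb hba.symm
  have hec : e ∈ K.classAt σ' a := ⟨e, he, heσ.trans hsub, .refl⟩
  have hae : (⟨{a}, hρK⟩ : K) ≤ ⟨e, he.1⟩ := fun x hx => by
    rw [Finset.mem_singleton.1 hx]; exact he.2.2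
  by_cases heq : e = σ.1
  · exact hspec.range_le h (heq ▸ hec) ⟨g, rfl⟩
  · have h₂ : (⟨e, he.1⟩ : K) < σ := lt_of_le_of_ne heσ fun h' => heq (congrArg Subtype.val h')
    have h₁ : (⟨{a}, hρK⟩ : K) < ⟨e, he.1⟩ := lt_of_le_of_ne hae fun h' => by
      have h1 : {a} = e := congrArg Subtype.val h'
      have h2 := he.2.1
      rw [← h1] at h2
      simp at h2
    have htw := hspec.twist_mem h₁ h₂ ⟨σ.2, σ.1, σ.2, subset_rfl, e, hec, heσ⟩
    have hcomp := 𝒢.ψ_comp h₁.le h₂.le g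
    have hmem := hspec.range_le hae hec ⟨𝒢.ψ h₂.le g, rfl⟩
    rw [← hcomp] at hmem
    have := (D.H ⟨{a}, hρK⟩ (K.classAt σ' a)).mul_mem
      ((D.H ⟨{a}, hρK⟩ (K.classAt σ' a)).mul_mem (Subgroup.inv_mem _ htw) hmem) htw
    simpa [mul_assoc] using this

theorem ψ_mem_of_eq {ρ σ : K} (h : ρ ≤ σ) (heq : ρ = σ) (c : Set (Finset V)) (g : 𝒢.G σ)
    (hg : g ∈ D.H σ c) : 𝒢.ψ h g ∈ D.H ρ c := by
  subst heq
  rwa [𝒢.ψ_refl]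

theorem ψ_mem_localGroup {t s : K.surgery} (h : t ≤ s) (g : 𝒢.G (K.collapseFace s))
    (hg : g ∈ D.localGroup s) : 𝒢.ψ (K.collapseFace_mono h) g ∈ D.localGroup t := by
  rw [mem_localGroup] at hg ⊢
  intro x c hx hl ht
  by_cases heq : K.collapseFace t = K.collapseFace s
  · exact D.ψ_mem_of_eq _ heq c g (hg x c (h hx) hl (heq ▸ ht))
  · have hs : (K.collapseFace s).1 ≠ {x.collapse} := fun hs => heq (Subtype.ext (ht.trans hs.symm))
    obtain ⟨σ', hσ', hcard, hsub, -, rfl⟩ := K.exists_thick (h hx) hl hs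
    exact D.ψ_mem_H _ ht hσ' hcard hsub hs g

theorem twist_mem_localGroup {r t s : K.surgery} (h₁ : r ≤ t) (h₂ : t ≤ s) :
    𝒢.twist (K.collapseFace_mono h₁) (K.collapseFace_mono h₂) ∈ D.localGroup r := by
  have hl1 : ∀ {ρ τ σ : K} (h : ρ ≤ τ) (h' : τ ≤ σ), ρ = τ ∨ τ = σ → 𝒢.twist h h' = 1 := by
    rintro ρ τ σ h h' (rfl | rfl)
    · exact 𝒢.twist_refl_left _
    · exact 𝒢.twist_refl_right _
  rw [mem_localGroup]
  intro x c hx hl hr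
  by_cases heq : K.collapseFace r = K.collapseFace t ∨ K.collapseFace t = K.collapseFace s
  · rw [hl1 _ _ heq]
    exact Subgroup.one_mem _
  · rw [not_or] at heq
    have hrt := lt_of_le_of_ne (K.collapseFace_mono h₁) heq.1
    have hts := lt_of_le_of_ne (K.collapseFace_mono h₂) heq.2
    have hs : (K.collapseFace s).1 ≠ {x.collapse} := fun hs =>
      (hrt.trans hts).ne (Subtype.ext (hr.trans hs.symm))
    obtain ⟨σ', hσ', hcard, hsub, hxσ, rfl⟩ := K.exists_thick (h₂ (h₁ hx)) hl hs
    have haK : {x.collapse} ∈ K := hr ▸ (K.collapseFace r).2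
    have hspec := D.spec _ haK _ (K.isCluster_classAt hσ' hcard hxσ)
    have hr' : K.collapseFace r = ⟨{x.collapse}, haK⟩ := Subtype.ext hr
    have hmem : (K.collapseFace s).1 ∈ K.clusterFaces (K.classAt σ' x.collapse) := by
      obtain ⟨e, he, hec⟩ : ∃ e, K.IsEdgeAt x.collapse e ∧ e ⊆ σ' := by
        obtain ⟨b, hb, hba⟩ := Finset.exists_mem_ne (by omega : 1 < σ'.card) x.collapse
        obtain ⟨e, he, -, heσ, -⟩ := K.isEdgeAt_pair hσ' hxσ hb hba.symm
        exact ⟨e, he, heσ⟩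
      exact ⟨(K.collapseFace s).2, σ', hσ', hsub, e, ⟨e, he, hec, .refl⟩, hec⟩
    rw [← hr'] at hspec
    exact hspec.twist_mem hrt hts hmem

/-- The complex of groups obtained from `𝒢` by surgery at all the vertices: its local groups are the
subgroups `localGroup`, with the restrictions of the local homomorphisms of `𝒢` and with the
twisting elements of `𝒢` (identities and trivial elements along the new segments). -/
noncomputable def surgered : ComplexOfGroups.{u, v} K.surgery :=
  (𝒢.pullback K.collapseFace K.collapseFace_mono).sub D.localGroup
    (fun h g hg => D.ψ_mem_localGroup h g hg) (fun h₁ h₂ => D.twist_mem_localGroup h₁ h₂)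

end SurgeryData

end ComplexOfGroups

/-!
The complex of groups obtained by surgery embeds into the given one over the collapse
`f : K.surgery → K`, so a morphism to a group that is injective on the local groups restricts to one
for the surgered complex: it is developable.

The fibres of `f` are points over the simplices of positive dimension (`eq_liftVertex_collapse`,
`liftFace_collapseFace`), and over a vertex `a` they are stars of segments of length two joining
`base a` to the vertices `copy a c`. Hence nothing happens to the fundamental group. To prove this
without covering theory, an inverse of the homomorphism of universal groups induced by `f` is
written down on paths: an edge `τ ≤ σ` of `K` is lifted to the path that runs in the fibre over `τ`
from the lift of `τ` to a face of the lift of `σ`, and then along an edge to the lift of `σ`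
(`TransportSystem.sectionMorphism`). Paths in the fibre conjugate the local groups by the inclusions
(`IsTransport`), so this respects the relations. One composite is the identity, and the other one
multiplies a path on both sides by paths in the fibres, which are trivial at the lifts
(`univHom_comp_desc`, `desc_univHom`).

For the graph, every connected component of the subcomplex spanned by the copies is collapsed to a
point. No vertex of another kind is identified with any other, and a simplex with vertices of both
kinds is of the form `[mid a c, copy a c]`; so the edges of the graph have unique preimages
(`surgeryGraph_edge_bijection`). The fibres are points and the components of copies. On the latter
the local homomorphisms have images of finite index by the second part of the weak qi condition, and
at the vertices by the first part: an element `ψ_{aσ}(x)` is conjugate by a twisting element in the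
cluster subgroup to `ψ_{ae}(ψ_{eσ}(x))`, where `e` is an edge of `σ` at `a`
(`IsClusterSubgroup.isFiniteRelIndex`). Finally, the cluster subgroups are finitely generated as
overgroups of finite index of images of finitely generated groups.
-/

/-! ### The universal group -/

namespace ComplexOfGroups

section Universal

variable {P : Type u} [PartialOrder P] (𝒢 : ComplexOfGroups.{u, v} P)

theorem twist_eq_one_left {ρ τ σ : P} (h₁ : ρ ≤ τ) (h₂ : τ ≤ σ) (h : ρ = τ) :
    𝒢.twist h₁ h₂ = 1 := by
  subst h
  exact 𝒢.twist_refl_left _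

theorem twist_eq_one_right {ρ τ σ : P} (h₁ : ρ ≤ τ) (h₂ : τ ≤ σ) (h : τ = σ) :
    𝒢.twist h₁ h₂ = 1 := by
  subst h
  exact 𝒢.twist_refl_right _

/-- The tautological morphism from a complex of groups to its universal group. -/
def univ : 𝒢.MorphismTo 𝒢.UniversalGroup where
  toHom σ := MonoidHom.mk' (fun x => PresentedGroup.of (.loc σ x)) fun x y =>
    (PresentedGroup.mk_eq_mk_of_mul_inv_mem (Relator.mul σ x y)).symm
  edge h := PresentedGroup.of (.edge h)
  conj h x := PresentedGroup.mk_eq_mk_of_mul_inv_mem (Relator.conj h x)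
  comp h₁ h₂ := (PresentedGroup.mk_eq_mk_of_mul_inv_mem (Relator.comp h₁ h₂)).symm

variable {𝒢}

namespace MorphismTo

variable {Γ : Type w} [Group Γ] (φ : 𝒢.MorphismTo Γ)

theorem edge_refl (σ : P) : φ.edge (le_refl σ) = 1 := by
  have h := φ.comp (le_refl σ) (le_refl σ)
  rw [𝒢.twist_refl_left, map_one, one_mul] at h
  exact (left_eq_mul.1 h)

theorem edge_eq_one {τ σ : P} (h : τ ≤ σ) (he : τ = σ) : φ.edge h = 1 := by
  subst he
  exact φ.edge_refl _

theorem edge_mul_edge_of_eq {ρ τ σ : P} (h₁ : ρ ≤ τ) (h₂ : τ ≤ σ) (h : 𝒢.twist h₁ h₂ = 1) :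
    φ.edge h₁ * φ.edge h₂ = φ.edge (h₁.trans h₂) := by
  rw [← φ.comp, h, map_one, one_mul]

theorem edge_congr {τ τ' σ σ' : P} (h : τ ≤ σ) (hτ : τ' = τ) (hσ : σ' = σ) :
    φ.edge (hτ.le.trans (h.trans hσ.ge)) = φ.edge h := by
  subst hτ hσ
  rfl

theorem toHom_ψ_of_eq {τ σ : P} (h : τ ≤ σ) (he : τ = σ) (x : 𝒢.G σ) :
    φ.toHom τ (𝒢.ψ h x) = φ.toHom σ x := by
  subst he
  rw [𝒢.ψ_refl]

/-- The homomorphism from the universal group that corresponds to a morphism. -/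
def desc : 𝒢.UniversalGroup →* Γ :=
  PresentedGroup.toGroup (f := fun g => match g with
    | .loc σ x => φ.toHom σ x
    | .edge h => φ.edge h) <| by
    rintro _ (⟨σ, x, y⟩ | ⟨h₁, h₂⟩ | ⟨h, x⟩)
    · simp
    · simp only [map_mul, map_inv, FreeGroup.lift_apply_of]
      rw [φ.comp, mul_inv_cancel]
    · simp only [map_mul, map_inv, FreeGroup.lift_apply_of]
      rw [φ.conj, mul_inv_cancel]

@[simp]
theorem desc_loc (σ : P) (x : 𝒢.G σ) : φ.desc (𝒢.univ.toHom σ x) = φ.toHom σ x :=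
  PresentedGroup.toGroup.of _

@[simp]
theorem desc_edge {τ σ : P} (h : τ ≤ σ) : φ.desc (𝒢.univ.edge h) = φ.edge h :=
  PresentedGroup.toGroup.of _

/-- The pullback of a morphism along a monotone map. -/
def pullback {Q : Type u} [PartialOrder Q] (f : Q → P) (hf : Monotone f) :
    (𝒢.pullback f hf).MorphismTo Γ where
  toHom σ := φ.toHom (f σ)
  edge h := φ.edge (hf h)
  conj h x := φ.conj (hf h) x
  comp h₁ h₂ := φ.comp (hf h₁) (hf h₂)

/-- The restriction of a morphism to a complex of subgroups. -/
def sub (L : ∀ σ, Subgroup (𝒢.G σ))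
    (hψ : ∀ {τ σ : P} (h : τ ≤ σ) (x : 𝒢.G σ), x ∈ L σ → 𝒢.ψ h x ∈ L τ)
    (ht : ∀ {ρ τ σ : P} (h₁ : ρ ≤ τ) (h₂ : τ ≤ σ), 𝒢.twist h₁ h₂ ∈ L ρ) :
    (𝒢.sub L hψ ht).MorphismTo Γ where
  toHom σ := (φ.toHom σ).comp (L σ).subtype
  edge h := φ.edge h
  conj h x := φ.conj h x.1
  comp h₁ h₂ := φ.comp h₁ h₂

end MorphismTo

theorem Developable.pullback (h : 𝒢.Developable) {Q : Type u} [PartialOrder Q] (f : Q → P)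
    (hf : Monotone f) : (𝒢.pullback f hf).Developable := by
  obtain ⟨Γ, _, φ, hφ⟩ := h
  exact ⟨Γ, _, φ.pullback f hf, fun σ => hφ (f σ)⟩

theorem Developable.sub (h : 𝒢.Developable) (L : ∀ σ, Subgroup (𝒢.G σ))
    (hψ : ∀ {τ σ : P} (h : τ ≤ σ) (x : 𝒢.G σ), x ∈ L σ → 𝒢.ψ h x ∈ L τ)
    (ht : ∀ {ρ τ σ : P} (h₁ : ρ ≤ τ) (h₂ : τ ≤ σ), 𝒢.twist h₁ h₂ ∈ L ρ) :
    (𝒢.sub L hψ ht).Developable := by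
  obtain ⟨Γ, _, φ, hφ⟩ := h
  exact ⟨Γ, _, φ.sub L hψ ht, fun σ => (hφ σ).comp Subtype.val_injective⟩

theorem universalGroup_hom_ext {Γ : Type w} [Group Γ] {α β : 𝒢.UniversalGroup →* Γ}
    (hloc : ∀ σ x, α (𝒢.univ.toHom σ x) = β (𝒢.univ.toHom σ x))
    (hedge : ∀ {τ σ : P} (h : τ ≤ σ), α (𝒢.univ.edge h) = β (𝒢.univ.edge h)) : α = β := by
  refine PresentedGroup.ext ?_
  rintro (⟨σ, x⟩ | h)
  · exact hloc σ x
  · exact hedge h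

theorem isPath_loc (σ : P) (x : 𝒢.G σ) : 𝒢.IsPath σ σ (𝒢.univ.toHom σ x) := .loc σ x

theorem isPath_edge {τ σ : P} (h : τ ≤ σ) : 𝒢.IsPath τ σ (𝒢.univ.edge h) := .edge h

theorem isPath_one (σ : P) : 𝒢.IsPath σ σ 1 := by
  simpa using 𝒢.isPath_loc σ 1

/-- Conjugation by the element of a path identifies the fundamental groups at its ends. -/
theorem nonempty_π₁_mulEquiv_of_isPath {σ τ : P} {x : 𝒢.UniversalGroup} (hx : 𝒢.IsPath σ τ x) :
    Nonempty (𝒢.π₁ σ ≃* 𝒢.π₁ τ) := by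
  refine ⟨MonoidHom.toMulEquiv
    (((MulAut.conj x⁻¹).toMonoidHom.comp (𝒢.π₁ σ).subtype).codRestrict _ ?_)
    (((MulAut.conj x).toMonoidHom.comp (𝒢.π₁ τ).subtype).codRestrict _ ?_) ?_ ?_⟩
  · rintro ⟨y, hy⟩
    simpa using show x⁻¹ * y * x ∈ 𝒢.π₁ τ from (hx.inv.mul hy).mul hx
  · rintro ⟨y, hy⟩
    simpa using show x * y * x⁻¹ ∈ 𝒢.π₁ σ from (hx.mul hy).mul hx.inv
  · ext ⟨y, hy⟩
    simp [mul_assoc]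
  · ext ⟨y, hy⟩
    simp [mul_assoc]

end Universal

end ComplexOfGroups

/-! ### Embeddings of complexes of groups and fundamental groups -/

namespace ComplexOfGroups

variable {P : Type u} [PartialOrder P] {Q : Type u} [PartialOrder Q]

/-- A section `ι` of a map of posets `f : Q → P`, together with lifts of the faces `τ ≤ σ` to faces
of `ι σ`. The section need not be monotone: the lift of `τ` to a face of `ι σ` may differ from
`ι τ`. The last two fields say that this only happens for minimal `τ`, and that `f` is one-to-one
away from the fibres of minimal elements. -/
structure FaceSection (f : Q → P) where
  ι : P → Q
  map_ι : ∀ σ, f (ι σ) = σ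
  lift : ∀ {τ σ : P}, τ ≤ σ → Q
  lift_le : ∀ {τ σ : P} (h : τ ≤ σ), lift h ≤ ι σ
  map_lift : ∀ {τ σ : P} (h : τ ≤ σ), f (lift h) = τ
  lift_lift : ∀ {ρ τ σ : P} (h₁ : ρ ≤ τ) (h₂ : τ ≤ σ),
    ρ = τ ∨ lift h₂ = ι τ ∧ lift h₁ = lift (h₁.trans h₂)
  eq_or_lift_eq : ∀ {t s : Q}, t ≤ s → f t = f s ∨ ι (f s) = s ∧ ∀ h : f t ≤ f s, lift h = t

/-- An embedding over `f : Q → P` of a complex of groups over `Q` into a complex of groups over `P`: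
monomorphisms of the local groups that respect the local homomorphisms and the twisting elements.
It is onto at the elements `ι σ` of the section, with inverse `sec`. -/
structure EmbeddingOver (𝒢' : ComplexOfGroups.{u, v} Q) (𝒢 : ComplexOfGroups.{u, v} P) {f : Q → P}
    (S : FaceSection f) where
  mono : Monotone f
  hom : ∀ s, 𝒢'.G s →* 𝒢.G (f s)
  hom_injective : ∀ s, Function.Injective (hom s)
  hom_ψ : ∀ {t s : Q} (h : t ≤ s) (x : 𝒢'.G s), hom t (𝒢'.ψ h x) = 𝒢.ψ (mono h) (hom s x)
  hom_twist : ∀ {r t s : Q} (h₁ : r ≤ t) (h₂ : t ≤ s),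
    hom r (𝒢'.twist h₁ h₂) = 𝒢.twist (mono h₁) (mono h₂)
  sec : ∀ σ, 𝒢.G σ →* 𝒢'.G (S.ι σ)
  hom_sec : ∀ (σ : P) (x : 𝒢.G σ), hom (S.ι σ) (sec σ x) = 𝒢.ψ (S.map_ι σ).le x

namespace EmbeddingOver

variable {𝒢' : ComplexOfGroups.{u, v} Q} {𝒢 : ComplexOfGroups.{u, v} P} {f : Q → P}
  {S : FaceSection f}

theorem twist_eq_one (E : EmbeddingOver 𝒢' 𝒢 S) {r t s : Q} (h₁ : r ≤ t) (h₂ : t ≤ s)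
    (h : f r = f t) :
    𝒢'.twist h₁ h₂ = 1 := by
  apply E.hom_injective
  rw [E.hom_twist, map_one, 𝒢.twist_eq_one_left _ _ h]

variable (E : EmbeddingOver 𝒢' 𝒢 S)

/-- The composite of a morphism to a group with an embedding. -/
def comp {Γ : Type w} [Group Γ] (φ : 𝒢.MorphismTo Γ) : 𝒢'.MorphismTo Γ where
  toHom s := (φ.toHom (f s)).comp (E.hom s)
  edge h := φ.edge (E.mono h)
  conj h x := by
    simp only [MonoidHom.comp_apply]
    rw [φ.conj, E.hom_ψ]
  comp h₁ h₂ := by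
    simp only [MonoidHom.comp_apply]
    rw [E.hom_twist, φ.comp]

/-- The homomorphism of universal groups induced by an embedding. -/
def univHom : 𝒢'.UniversalGroup →* 𝒢.UniversalGroup := (E.comp 𝒢.univ).desc

@[simp]
theorem univHom_loc (s : Q) (x : 𝒢'.G s) :
    E.univHom (𝒢'.univ.toHom s x) = 𝒢.univ.toHom (f s) (E.hom s x) :=
  (E.comp 𝒢.univ).desc_loc s x

@[simp]
theorem univHom_edge {t s : Q} (h : t ≤ s) :
    E.univHom (𝒢'.univ.edge h) = 𝒢.univ.edge (E.mono h) :=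
  (E.comp 𝒢.univ).desc_edge h

theorem isPath_univHom {s t : Q} {x : 𝒢'.UniversalGroup} (hx : 𝒢'.IsPath s t x) :
    𝒢.IsPath (f s) (f t) (E.univHom x) := by
  induction hx with
  | loc s x => exact (E.univHom_loc s x).symm ▸ isPath_loc _ _
  | edge h => exact (E.univHom_edge h).symm ▸ isPath_edge _
  | inv _ ih => exact (map_inv E.univHom _).symm ▸ ih.inv
  | mul _ _ ih₁ ih₂ => exact (map_mul E.univHom _ _).symm ▸ ih₁.mul ih₂

/-- The group `G_σ` as the local group at `ι σ`, inside the universal group upstairs. -/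
def sectionHom (σ : P) : 𝒢.G σ →* 𝒢'.UniversalGroup :=
  (𝒢'.univ.toHom (S.ι σ)).comp (E.sec σ)

theorem sectionHom_ψ_of_eq {τ σ : P} (h : τ ≤ σ) (he : τ = σ) (x : 𝒢.G σ) :
    E.sectionHom τ (𝒢.ψ h x) = E.sectionHom σ x := by
  subst he
  rw [𝒢.ψ_refl]

theorem univHom_sectionHom (σ : P) (x : 𝒢.G σ) :
    E.univHom (E.sectionHom σ x) = 𝒢.univ.toHom σ x := by
  rw [sectionHom, MonoidHom.comp_apply, univHom_loc, E.hom_sec,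
    𝒢.univ.toHom_ψ_of_eq _ (S.map_ι σ)]

/-- `g` is represented by a path from `ι (f s)` to `s` that runs in the fibre over `f s` and carries
the local group at `s` into the one at `ι (f s)` by the inclusion. -/
structure IsTransport (s : Q) (g : 𝒢'.UniversalGroup) : Prop where
  isPath : 𝒢'.IsPath (S.ι (f s)) s g
  univHom_eq_one : E.univHom g = 1
  conj : ∀ x : 𝒢'.G s, g * 𝒢'.univ.toHom s x * g⁻¹ = E.sectionHom (f s) (E.hom s x)

variable {E}

theorem isTransport_section (σ : P) : E.IsTransport (S.ι σ) 1 where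
  isPath := by
    rw [S.map_ι]
    exact isPath_one _
  univHom_eq_one := map_one _
  conj x := by
    rw [one_mul, inv_one, mul_one]
    have hι : S.ι (f (S.ι σ)) = S.ι σ := congrArg S.ι (S.map_ι σ)
    rw [sectionHom, MonoidHom.comp_apply, ← 𝒢'.univ.toHom_ψ_of_eq hι.le hι]
    congr 1
    apply E.hom_injective
    rw [E.hom_sec, E.hom_ψ]

theorem IsTransport.up {t s : Q} {g : 𝒢'.UniversalGroup} (hg : E.IsTransport t g) (h : t ≤ s)
    (he : f t = f s) : E.IsTransport s (g * 𝒢'.univ.edge h) where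
  isPath := by
    rw [← he]
    exact hg.isPath.mul (isPath_edge h)
  univHom_eq_one := by
    rw [map_mul, hg.univHom_eq_one, univHom_edge, MorphismTo.edge_eq_one _ _ he, one_mul]
  conj x := by
    have h2 := hg.conj (𝒢'.ψ h x)
    rw [← 𝒢'.univ.conj h x, E.hom_ψ, E.sectionHom_ψ_of_eq _ he] at h2
    rw [← h2]
    group

theorem IsTransport.down {t s : Q} {g : 𝒢'.UniversalGroup} (hg : E.IsTransport s g) (h : t ≤ s)
    (he : f t = f s) (hsurj : Function.Surjective (𝒢'.ψ h)) :
    E.IsTransport t (g * (𝒢'.univ.edge h)⁻¹) where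
  isPath := by
    rw [he]
    exact hg.isPath.mul (isPath_edge h).inv
  univHom_eq_one := by
    rw [map_mul, map_inv, hg.univHom_eq_one, univHom_edge, MorphismTo.edge_eq_one _ _ he, one_mul,
      inv_one]
  conj x := by
    obtain ⟨y, rfl⟩ := hsurj x
    rw [← 𝒢'.univ.conj h y, E.hom_ψ, E.sectionHom_ψ_of_eq _ he, ← hg.conj y]
    group

variable (E) in
/-- A choice of transports that is trivial on the section and compatible with the edges in the
fibres. -/
structure TransportSystem where
  u : Q → 𝒢'.UniversalGroup
  isTransport : ∀ s, E.IsTransport s (u s)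
  u_ι : ∀ σ, u (S.ι σ) = 1
  u_mul_edge : ∀ {t s : Q} (h : t ≤ s), f t = f s → u t * 𝒢'.univ.edge h = u s

namespace TransportSystem

variable (T : E.TransportSystem)

/-- The morphism to the universal group upstairs that lifts the edge `τ ≤ σ` to the path that runs
from `ι τ` to the lift of `τ` below `ι σ` in the fibre over `τ`, and then along an edge to
`ι σ`. -/
def sectionMorphism : 𝒢.MorphismTo 𝒢'.UniversalGroup where
  toHom σ := E.sectionHom σ
  edge h := T.u (S.lift h) * 𝒢'.univ.edge (S.lift_le h)
  conj {τ σ} h x := by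
    have h1 := 𝒢'.univ.conj (S.lift_le h) (E.sec σ x)
    have h2 := (T.isTransport (S.lift h)).conj (𝒢'.ψ (S.lift_le h) (E.sec σ x))
    have h3 : E.sectionHom (f (S.lift h)) (𝒢.ψ (E.mono (S.lift_le h)) (𝒢.ψ (S.map_ι σ).le x)) =
        E.sectionHom τ (𝒢.ψ h x) := by
      have h4 : 𝒢.ψ (E.mono (S.lift_le h)) (𝒢.ψ (S.map_ι σ).le x) =
          𝒢.ψ (S.map_lift h).le (𝒢.ψ h x) := by
        rw [← 𝒢.ψ_comp, ← 𝒢.ψ_comp, 𝒢.twist_eq_one_left _ _ (S.map_lift h),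
          𝒢.twist_eq_one_right _ _ (S.map_ι σ)]
      rw [h4, E.sectionHom_ψ_of_eq _ (S.map_lift h)]
    rw [E.hom_ψ, E.hom_sec, h3, ← h1] at h2
    rw [← h2, sectionHom, MonoidHom.comp_apply]
    group
  comp {ρ τ σ} h₁ h₂ := by
    rcases S.lift_lift h₁ h₂ with rfl | ⟨h3, h4⟩
    · rw [𝒢.twist_eq_one_left _ _ rfl, map_one, one_mul,
        T.u_mul_edge (S.lift_le h₁) ((S.map_lift _).trans (S.map_ι _).symm), T.u_ι, one_mul]
    · -- equal faces are replaced by variables, as the edges depend on them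
      have key : ∀ (r r' t s : Q) (hr : r = r') (hrt : r ≤ t) (hrs : r' ≤ s) (hts : t ≤ s)
          (hr' : f r' = ρ) (ht' : f t = τ) (hs' : f s = σ),
          E.sectionHom ρ (𝒢.twist h₁ h₂) * (T.u r' * 𝒢'.univ.edge hrs) =
          T.u r * 𝒢'.univ.edge hrt * 𝒢'.univ.edge hts := by
        rintro r _ t s rfl hrt hrs hts rfl rfl rfl
        have h5 := (T.isTransport r).conj (𝒢'.twist hrt hts)
        rw [E.hom_twist] at h5
        rw [← h5, mul_assoc _ _ (𝒢'.univ.edge hts), ← 𝒢'.univ.comp hrt hts]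
        group
      have := key _ _ (S.ι τ) _ h4 (S.lift_le h₁) (S.lift_le (h₁.trans h₂)) (h3 ▸ S.lift_le h₂)
        (S.map_lift _) (S.map_ι _) (S.map_ι _)
      rw [this]
      have h6 : T.u (S.lift h₂) = 1 := by rw [h3, T.u_ι]
      rw [h6, one_mul]
      congr 1
      exact (𝒢'.univ.edge_congr (S.lift_le h₂) h3.symm rfl)

theorem univHom_comp_desc :
    E.univHom.comp T.sectionMorphism.desc = MonoidHom.id 𝒢.UniversalGroup := by
  refine universalGroup_hom_ext (fun σ x => ?_) fun {τ σ} h => ?_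
  · rw [MonoidHom.comp_apply, MorphismTo.desc_loc]
    exact E.univHom_sectionHom σ x
  · rw [MonoidHom.comp_apply, MorphismTo.desc_edge]
    change E.univHom (T.u (S.lift h) * 𝒢'.univ.edge (S.lift_le h)) = _
    rw [map_mul, (T.isTransport _).univHom_eq_one, one_mul, univHom_edge]
    exact 𝒢.univ.edge_congr h (S.map_lift h) (S.map_ι σ)

theorem isPath_desc {σ τ : P} {x : 𝒢.UniversalGroup} (hx : 𝒢.IsPath σ τ x) :
    𝒢'.IsPath (S.ι σ) (S.ι τ) (T.sectionMorphism.desc x) := by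
  induction hx with
  | loc s x => exact (T.sectionMorphism.desc_loc s x).symm ▸ isPath_loc _ _
  | @edge τ σ h =>
    have h1 := (T.isTransport (S.lift h)).isPath
    rw [S.map_lift] at h1
    exact (T.sectionMorphism.desc_edge h).symm ▸ h1.mul (isPath_edge _)
  | inv _ ih => exact (map_inv T.sectionMorphism.desc _).symm ▸ ih.inv
  | mul _ _ ih₁ ih₂ => exact (map_mul T.sectionMorphism.desc _ _).symm ▸ ih₁.mul ih₂

theorem desc_univHom {s t : Q} {x : 𝒢'.UniversalGroup} (hx : 𝒢'.IsPath s t x) :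
    T.sectionMorphism.desc (E.univHom x) = T.u s * x * (T.u t)⁻¹ := by
  induction hx with
  | loc s x =>
    refine (congrArg _ (E.univHom_loc s x)).trans ?_
    rw [MorphismTo.desc_loc]
    exact ((T.isTransport s).conj x).symm
  | @edge t s h =>
    refine (congrArg _ (E.univHom_edge h)).trans ?_
    change _ = T.u t * 𝒢'.univ.edge h * (T.u s)⁻¹
    rcases S.eq_or_lift_eq h with he | ⟨h1, h2⟩
    · rw [T.u_mul_edge h he, mul_inv_cancel, MorphismTo.edge_eq_one _ _ he, map_one]
    · rw [MorphismTo.desc_edge]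
      change T.u (S.lift (E.mono h)) * 𝒢'.univ.edge (S.lift_le (E.mono h)) = _
      have h3 : T.u s = 1 := by rw [← h1, T.u_ι]
      rw [h3, inv_one, mul_one]
      congr 1
      · rw [h2]
      exact (𝒢'.univ.edge_congr h (h2 _) h1)
  | inv _ ih =>
    rw [map_inv, map_inv, ih]
    group
  | mul _ _ ih₁ ih₂ =>
    rw [map_mul, map_mul, ih₁, ih₂]
    group

/-- An embedding over `f` that admits transports in the fibres is an isomorphism on fundamental
groups. -/
theorem nonempty_π₁_mulEquiv (T : E.TransportSystem) (σ : P) :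
    Nonempty (𝒢.π₁ σ ≃* 𝒢'.π₁ (S.ι σ)) := by
  refine ⟨MonoidHom.toMulEquiv
    ((T.sectionMorphism.desc.comp (𝒢.π₁ σ).subtype).codRestrict _ fun x => T.isPath_desc x.2)
    ((E.univHom.comp (𝒢'.π₁ (S.ι σ)).subtype).codRestrict _ fun x => ?_) ?_ ?_⟩
  · have h := E.isPath_univHom x.2
    rw [S.map_ι] at h
    exact h
  · ext x
    exact DFunLike.congr_fun T.univHom_comp_desc x.1
  · ext x
    refine (T.desc_univHom x.2).trans ?_
    rw [T.u_ι]
    simp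

end TransportSystem

end EmbeddingOver

end ComplexOfGroups

/-! ### The combinatorics of the surgery -/

namespace PreAbstractSimplicialComplex

open SurgeryVertex

variable {V : Type u} (K : PreAbstractSimplicialComplex V)

theorem nonempty_of_mem {s : Finset V} (hs : s ∈ K) : s.Nonempty :=
  (K.isRelLowerSet_faces hs).1

theorem classAt_eq_edgeClass {σ e : Finset V} {a : V} (hσ : σ ∈ K) (he : K.IsEdgeAt a e)
    (heσ : e ⊆ σ) : K.classAt σ a = K.edgeClass a e := by
  ext f
  constructor
  · rintro ⟨g, hg, hgσ, hf⟩
    exact Relation.ReflTransGen.head ⟨he, hg, σ, hσ, heσ, hgσ⟩ hf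
  · exact fun hf => ⟨e, he, heσ, hf⟩

theorem exists_isEdgeAt_subset {σ : Finset V} {a : V} (hσ : σ ∈ K) (ha : a ∈ σ)
    (hcard : 2 ≤ σ.card) : ∃ e, K.IsEdgeAt a e ∧ e ⊆ σ := by
  obtain ⟨b, hb, hba⟩ := Finset.exists_mem_ne (by omega : 1 < σ.card) a
  obtain ⟨e, he, -, heσ, -⟩ := K.isEdgeAt_pair hσ ha hb hba.symm
  exact ⟨e, he, heσ⟩

theorem classAt_eq_of_subset {σ σ' : Finset V} {a : V} (hσ' : σ' ∈ K) (h : σ ⊆ σ') (ha : a ∈ σ)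
    (hcard : 2 ≤ σ.card) : K.classAt σ a = K.classAt σ' a := by
  have hσ : σ ∈ K := K.mem_of_subset hσ' h ⟨a, ha⟩
  obtain ⟨e, he, heσ⟩ := K.exists_isEdgeAt_subset hσ ha hcard
  rw [K.classAt_eq_edgeClass hσ he heσ, K.classAt_eq_edgeClass hσ' he (heσ.trans h)]

open scoped Classical in
/-- The vertex of the complex obtained by surgery that replaces the vertex `a` of a simplex `σ` of
`K`: the copy of `a` if `σ` has positive dimension and is contained in a simplex of dimension at
least two, and `base a` otherwise. -/
noncomputable def liftVertex (σ : Finset V) (a : V) : SurgeryVertex V :=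
  if 2 ≤ σ.card ∧ ∃ σ' ∈ K, 3 ≤ σ'.card ∧ σ ⊆ σ' then copy a (K.classAt σ a) else base a

@[simp]
theorem collapse_liftVertex (σ : Finset V) (a : V) : (K.liftVertex σ a).collapse = a := by
  unfold liftVertex
  split_ifs <;> rfl

open scoped Classical in
theorem image_collapse_image_liftVertex (σ τ : Finset V) :
    (τ.image (K.liftVertex σ)).image collapse = τ := by
  rw [Finset.image_image]
  have : collapse ∘ K.liftVertex σ = id := funext fun a => K.collapse_liftVertex σ a
  rw [this, Finset.image_id]

open scoped Classical in
theorem image_liftVertex_mem {σ τ : Finset V} (hσ : σ ∈ K) (hτ : τ.Nonempty) (h : τ ⊆ σ) :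
    τ.image (K.liftVertex σ) ∈ K.surgery := by
  refine ⟨hτ.image _, ?_⟩
  by_cases hthick : 2 ≤ σ.card ∧ ∃ σ' ∈ K, 3 ≤ σ'.card ∧ σ ⊆ σ'
  · obtain ⟨hcard, σ', hσ', hcard', hsub⟩ := id hthick
    refine ⟨_, .thick σ' hσ' hcard', ?_⟩
    intro x hx
    obtain ⟨a, ha, rfl⟩ := Finset.mem_image.1 hx
    refine Finset.mem_image.2 ⟨a, hsub (h ha), ?_⟩
    rw [liftVertex, if_pos hthick, K.classAt_eq_of_subset hσ' hsub (h ha) hcard]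
  · have hbase : K.liftVertex σ = base := funext fun a => if_neg hthick
    rw [hbase]
    have hpos := (K.nonempty_of_mem hσ).card_pos
    obtain h1 | h2 : σ.card = 1 ∨ 2 ≤ σ.card := by omega
    · obtain ⟨a, rfl⟩ := Finset.card_eq_one.1 h1
      refine ⟨_, .vertex a hσ, ?_⟩
      exact (Finset.image_subset_image h).trans (by simp)
    · have h3 : ¬ 3 ≤ σ.card := fun h3 => hthick ⟨h2, σ, hσ, h3, subset_rfl⟩
      refine ⟨_, .edge σ hσ (by omega) ?_, Finset.image_subset_image h⟩
      intro τ' hτ' hsub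
      by_contra hne
      refine hthick ⟨h2, τ', hτ', ?_, hsub⟩
      have := Finset.card_lt_card (hsub.ssubset_of_ne fun h => hne h.symm)
      omega

open scoped Classical in
/-- The face over `τ` of the simplex that replaces `σ`. -/
noncomputable def liftFace {τ σ : K} (h : τ ≤ σ) : K.surgery :=
  ⟨τ.1.image (K.liftVertex σ.1), K.image_liftVertex_mem σ.2 (K.nonempty_of_mem τ.2) h⟩

theorem collapseFace_liftFace {τ σ : K} (h : τ ≤ σ) : K.collapseFace (K.liftFace h) = τ :=
  Subtype.ext (K.image_collapse_image_liftVertex _ _)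

theorem collapse_mem_collapseFace {s : K.surgery} {x : SurgeryVertex V} (hx : x ∈ s.1) :
    x.collapse ∈ (K.collapseFace s).1 := by
  classical
  exact Finset.mem_image_of_mem _ hx

/-- A simplex that is not collapsed to a vertex consists of the vertices that replace those of its
image. -/
theorem eq_liftVertex_collapse {s : K.surgery} (h : 2 ≤ (K.collapseFace s).1.card)
    {x : SurgeryVertex V} (hx : x ∈ s.1) :
    x = K.liftVertex (K.collapseFace s).1 x.collapse := by
  classical
  have hxs := K.collapse_mem_collapseFace hx
  have hf := (K.collapseFace s).2
  obtain ⟨t, ht, hst⟩ := s.2.2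
  have hft : (K.collapseFace s).1 ⊆ t.image collapse := Finset.image_subset_image hst
  generalize (K.collapseFace s).1 = σ at h hxs hf hft
  replace hx := hst hx
  clear hst
  cases ht with
  | vertex a ha =>
    have := Finset.card_le_card hft
    simp at this
    omega
  | inner a c ha _ =>
    have := Finset.card_le_card hft
    simp [collapse] at this
    omega
  | outer a c ha _ =>
    have := Finset.card_le_card hft
    simp [collapse] at this
    omega
  | edge e he hcard hmax =>
    rw [Finset.image_image, show (collapse ∘ base : V → V) = id from rfl, Finset.image_id] at hft
    obtain rfl : σ = e := Finset.eq_of_subset_of_card_le hft (by omega)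
    obtain ⟨a, ha, rfl⟩ := Finset.mem_image.1 hx
    rw [liftVertex, if_neg]
    · rfl
    · rintro ⟨-, σ', hσ', hcard', hsub⟩
      rw [hmax σ' hσ' hsub] at hcard'
      omega
  | thick σ' hσ' hcard =>
    rw [Finset.image_image,
      show (collapse ∘ fun a => copy a (K.classAt σ' a) : V → V) = id from rfl,
      Finset.image_id] at hft
    obtain ⟨a, ha, rfl⟩ := Finset.mem_image.1 hx
    rw [liftVertex, if_pos ⟨h, σ', hσ', hcard, hft⟩, K.classAt_eq_of_subset hσ' hft hxs h]
    rfl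

theorem liftFace_collapseFace {t s : K.surgery} (h : t ≤ s) (hs : 2 ≤ (K.collapseFace s).1.card)
    (h' : K.collapseFace t ≤ K.collapseFace s) : K.liftFace h' = t := by
  classical
  refine Subtype.ext (Finset.ext fun x => ?_)
  constructor
  · intro hx
    obtain ⟨a, ha, rfl⟩ := Finset.mem_image.1 hx
    obtain ⟨y, hy, rfl⟩ := Finset.mem_image.1 ha
    rwa [← K.eq_liftVertex_collapse hs (h hy)]
  · intro hx
    rw [K.eq_liftVertex_collapse hs (h hx)]
    exact Finset.mem_image_of_mem _ (K.collapse_mem_collapseFace hx)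

theorem eq_of_le_of_card_le_one {τ σ : K} (h : τ ≤ σ) (hσ : σ.1.card ≤ 1) : τ = σ := by
  refine Subtype.ext (Finset.eq_of_subset_of_card_le h ?_)
  have := (K.nonempty_of_mem τ.2).card_pos
  omega

/-- The section of the collapse that replaces every simplex by the corresponding simplex of the
complex obtained by surgery. It is not monotone at the vertices. -/
noncomputable def surgerySection : ComplexOfGroups.FaceSection K.collapseFace where
  ι σ := K.liftFace (le_refl σ)
  map_ι σ := K.collapseFace_liftFace _
  lift h := K.liftFace h
  lift_le h := by
    classical
    exact Finset.image_subset_image h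
  map_lift h := K.collapseFace_liftFace h
  lift_lift {ρ τ σ} h₁ h₂ := by
    classical
    by_cases hτ : τ.1.card ≤ 1
    · exact Or.inl (K.eq_of_le_of_card_le_one h₁ hτ)
    · have hcard : 2 ≤ (K.collapseFace (K.liftFace h₂)).1.card := by
        rw [K.collapseFace_liftFace]; omega
      have key : ∀ a ∈ τ.1, K.liftVertex σ.1 a = K.liftVertex τ.1 a := by
        intro a ha
        have := K.eq_liftVertex_collapse hcard (Finset.mem_image_of_mem _ ha)
        rwa [K.collapseFace_liftFace, collapse_liftVertex] at this
      exact Or.inr ⟨Subtype.ext (Finset.image_congr key),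
        Subtype.ext (Finset.image_congr fun a ha => (key a (h₁ ha)).symm)⟩
  eq_or_lift_eq {t s} h := by
    by_cases hs : (K.collapseFace s).1.card ≤ 1
    · exact Or.inl (K.eq_of_le_of_card_le_one (K.collapseFace_mono h) hs)
    · exact Or.inr ⟨K.liftFace_collapseFace le_rfl (by omega) _,
        fun h' => K.liftFace_collapseFace h (by omega) h'⟩

theorem liftVertex_singleton (a : V) : K.liftVertex {a} a = base a := by
  rw [liftVertex, if_neg]
  simp

theorem surgerySection_ι_singleton {a : V} (ha : {a} ∈ K) :
    (K.surgerySection.ι ⟨{a}, ha⟩).1 = {base a} := by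
  classical
  change Finset.image _ _ = _
  rw [Finset.image_singleton, liftVertex_singleton]

theorem singleton_base_mem {a : V} (ha : {a} ∈ K) : {base a} ∈ K.surgery :=
  ⟨by simp, _, .vertex a ha, subset_rfl⟩

theorem singleton_mem_of_mem {s : Finset V} (hs : s ∈ K) {a : V} (ha : a ∈ s) : {a} ∈ K :=
  K.mem_of_subset hs (by simpa using ha) (by simp)

theorem isCluster_of_hasLabel {x : SurgeryVertex V} (hx : {x} ∈ K.surgery) {c : Set (Finset V)}
    (hl : x.HasLabel c) : {x.collapse} ∈ K ∧ K.IsCluster x.collapse c := by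
  classical
  obtain ⟨-, t, ht, hxt⟩ := hx
  rw [Finset.singleton_subset_iff] at hxt
  cases ht with
  | vertex a ha =>
    obtain rfl := Finset.mem_singleton.1 hxt
    exact hl.elim
  | edge e _ _ _ =>
    obtain ⟨a, _, rfl⟩ := Finset.mem_image.1 hxt
    exact hl.elim
  | inner a c' ha hc =>
    rw [Finset.mem_insert, Finset.mem_singleton] at hxt
    rcases hxt with rfl | rfl
    · exact hl.elim
    · obtain rfl : c' = c := hl
      exact ⟨ha, hc⟩
  | outer a c' ha hc =>
    rw [Finset.mem_insert, Finset.mem_singleton] at hxt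
    rcases hxt with rfl | rfl
    · obtain rfl : c' = c := hl
      exact ⟨ha, hc⟩
    · obtain rfl : c' = c := hl
      exact ⟨ha, hc⟩
  | thick σ hσ hcard =>
    obtain ⟨a, ha, rfl⟩ := Finset.mem_image.1 hxt
    obtain rfl : K.classAt σ a = c := hl
    exact ⟨K.singleton_mem_of_mem hσ ha, K.isCluster_classAt hσ hcard ha⟩

theorem singleton_collapse_mem {x : SurgeryVertex V} (hx : {x} ∈ K.surgery) :
    {x.collapse} ∈ K := by
  simpa using K.image_collapse_mem hx

open scoped Classical in
theorem inner_mem {a : V} {c : Set (Finset V)} (ha : {a} ∈ K) (hc : K.IsCluster a c) :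
    {base a, mid a c} ∈ K.surgery :=
  ⟨by simp, _, .inner a c ha hc, subset_rfl⟩

open scoped Classical in
theorem outer_mem {a : V} {c : Set (Finset V)} (ha : {a} ∈ K) (hc : K.IsCluster a c) :
    {mid a c, copy a c} ∈ K.surgery :=
  ⟨by simp, _, .outer a c ha hc, subset_rfl⟩

theorem _root_.Finset.eq_singleton_or_eq_of_subset_pair {α : Type*} [DecidableEq α] {s : Finset α}
    {x y : α} (hs : s.Nonempty) (h : s ⊆ {x, y}) : (∃ z, s = {z}) ∨ s = {x, y} := by
  rw [← Finset.card_eq_one, or_iff_not_imp_left]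
  intro h1
  have h2 := hs.card_pos
  have h3 : ({x, y} : Finset α).card ≤ 2 := Finset.card_le_two
  exact Finset.eq_of_subset_of_card_le h (by omega)

open scoped Classical in
/-- The simplices that are collapsed to vertices are vertices or halves of new segments. -/
theorem eq_of_card_collapseFace_le_one {s : K.surgery} (h : (K.collapseFace s).1.card ≤ 1) :
    (∃ x, s.1 = {x}) ∨ ∃ a c, {a} ∈ K ∧ K.IsCluster a c ∧
      (s.1 = {base a, mid a c} ∨ s.1 = {mid a c, copy a c}) := by
  have hne := s.2.1
  -- a simplex on which the collapse is injective has as many vertices as its image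
  have hinj : ∀ g : V → SurgeryVertex V, (∀ a, (g a).collapse = a) → ∀ t : Finset V,
      s.1 ⊆ t.image g → ∃ x, s.1 = {x} := by
    intro g hg t hst
    rw [← Finset.card_eq_one]
    have h1 : (K.collapseFace s).1.card = s.1.card := by
      refine Finset.card_image_of_injOn ?_
      intro x hx y hy hxy
      obtain ⟨a, -, rfl⟩ := Finset.mem_image.1 (hst hx)
      obtain ⟨b, -, rfl⟩ := Finset.mem_image.1 (hst hy)
      rw [hg, hg] at hxy
      rw [hxy]
    have := hne.card_pos
    omega
  obtain ⟨t, ht, hst⟩ := s.2.2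
  cases ht with
  | vertex a ha => exact Or.inl (hinj base (fun _ => rfl) {a} (by simpa using hst))
  | edge e _ _ _ => exact Or.inl (hinj base (fun _ => rfl) e hst)
  | thick σ hσ hcard => exact Or.inl (hinj _ (fun _ => rfl) σ hst)
  | inner a c ha hc =>
    exact (Finset.eq_singleton_or_eq_of_subset_pair hne hst).imp_right fun h =>
      ⟨a, c, ha, hc, Or.inl h⟩
  | outer a c ha hc =>
    exact (Finset.eq_singleton_or_eq_of_subset_pair hne hst).imp_right fun h =>
      ⟨a, c, ha, hc, Or.inr h⟩

end PreAbstractSimplicialComplex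

/-! ### The fundamental group of the surgered complex -/

namespace ComplexOfGroups.SurgeryData

open PreAbstractSimplicialComplex SurgeryVertex

variable {V : Type u} {K : PreAbstractSimplicialComplex V} {𝒢 : ComplexOfGroups.{u, v} K}
  (D : 𝒢.SurgeryData)

theorem localGroup_eq_top {s : K.surgery}
    (h : ∀ x ∈ s.1, (K.collapseFace s).1 = {x.collapse} → ∀ c, ¬ x.HasLabel c) :
    D.localGroup s = ⊤ := by
  rw [eq_top_iff]
  intro g _
  rw [mem_localGroup]
  intro x c hx hl hs
  exact (h x hx hs c hl).elim

theorem localGroup_eq_top_of_two_le_card {s : K.surgery} (h : 2 ≤ (K.collapseFace s).1.card) :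
    D.localGroup s = ⊤ :=
  D.localGroup_eq_top fun x _ hs => by
    rw [hs] at h
    simp at h

theorem localGroup_ι (σ : K) : D.localGroup (K.surgerySection.ι σ) = ⊤ := by
  classical
  refine D.localGroup_eq_top fun x hx hs c hl => ?_
  rw [K.surgerySection.map_ι] at hs
  obtain ⟨a, ha, rfl⟩ := Finset.mem_image.1 hx
  rw [liftVertex, if_neg] at hl
  · exact hl
  · rw [hs]
    simp

/-- The embedding over the collapse of the complex of groups obtained by surgery. -/
noncomputable def embedding : EmbeddingOver D.surgered 𝒢 K.surgerySection where
  mono := K.collapseFace_mono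
  hom s := (D.localGroup s).subtype
  hom_injective s := Subtype.val_injective
  hom_ψ _ _ := rfl
  hom_twist _ _ := rfl
  sec σ := (𝒢.ψ (K.surgerySection.map_ι σ).le).codRestrict (D.localGroup _) fun x => by
    rw [localGroup_ι]
    exact Subgroup.mem_top _
  hom_sec _ _ := rfl

/-- The local homomorphisms of the surgered complex along the new segments are onto, unless they
leave a vertex `base a`. -/
theorem surgered_ψ_surjective {t s : K.surgery} (h : t ≤ s)
    (he : K.collapseFace t = K.collapseFace s)
    (hl : ∀ x ∈ s.1, ∀ c, x.HasLabel c → ∃ y ∈ t.1, y.HasLabel c) :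
    Function.Surjective (D.surgered.ψ h) := by
  have hmem : ∀ y ∈ D.localGroup t, 𝒢.ψ he.ge y ∈ D.localGroup s := by
    intro y hy
    rw [mem_localGroup] at hy ⊢
    intro x c hx hlx hs
    obtain ⟨x', hx', hl'⟩ := hl x hx c hlx
    refine D.ψ_mem_of_eq he.ge he.symm c y (hy x' c hx' hl' ?_)
    have h1 := K.collapse_mem_collapseFace hx'
    rw [he, hs, Finset.mem_singleton] at h1
    rw [he, hs, h1]
  rintro ⟨y, hy⟩
  refine ⟨⟨_, hmem y hy⟩, D.embedding.hom_injective t ?_⟩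
  have := 𝒢.ψ_comp (K.collapseFace_mono h) he.ge y
  rw [𝒢.twist_eq_one_left _ _ he, one_mul, inv_one, mul_one] at this
  exact this.symm.trans (𝒢.ψ_refl _ _)

open scoped Classical in
/-- The generator of the universal group at an edge between two simplices, and `1` if the sets are
not simplices one of which contains the other. -/
noncomputable def edgeElt (t s : Finset (SurgeryVertex V)) : D.surgered.UniversalGroup :=
  if h : ∃ (_ : t ∈ K.surgery) (_ : s ∈ K.surgery), t ⊆ s then
    D.surgered.univ.edge (show (⟨t, h.1⟩ : K.surgery) ≤ ⟨s, h.2.1⟩ from h.2.2)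
  else 1

theorem edgeElt_eq {t s : K.surgery} (h : t ≤ s) :
    D.edgeElt t.1 s.1 = D.surgered.univ.edge h :=
  dif_pos ⟨t.2, s.2, h⟩

open scoped Classical in
/-- The path in the new segments from the vertex `base a` to `x`, where `a` is the vertex to which
`x` is collapsed. -/
noncomputable def vertexTransport : SurgeryVertex V → D.surgered.UniversalGroup
  | base _ => 1
  | mid a c => D.edgeElt {base a} {base a, mid a c} * (D.edgeElt {mid a c} {base a, mid a c})⁻¹
  | copy a c => D.edgeElt {base a} {base a, mid a c} * (D.edgeElt {mid a c} {base a, mid a c})⁻¹ *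
      D.edgeElt {mid a c} {mid a c, copy a c} * (D.edgeElt {copy a c} {mid a c, copy a c})⁻¹

theorem isTransport_vertexTransport {x : SurgeryVertex V} (hx : {x} ∈ K.surgery) :
    D.embedding.IsTransport ⟨{x}, hx⟩ (D.vertexTransport x) := by
  classical
  have hbase : ∀ a (ha : {base a} ∈ K.surgery),
      D.embedding.IsTransport ⟨{base a}, ha⟩ (D.vertexTransport (base a)) := by
    intro a ha
    have haK : {a} ∈ K := K.singleton_collapse_mem ha
    have h1 := EmbeddingOver.isTransport_section (E := D.embedding) ⟨{a}, haK⟩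
    rwa [show K.surgerySection.ι ⟨{a}, haK⟩ = ⟨{base a}, ha⟩ from
      Subtype.ext (K.surgerySection_ι_singleton haK)] at h1
  have hmid : ∀ a c (ha : {mid a c} ∈ K.surgery),
      D.embedding.IsTransport ⟨{mid a c}, ha⟩ (D.vertexTransport (mid a c)) := by
    intro a c ha
    obtain ⟨haK, hc⟩ : {a} ∈ K ∧ K.IsCluster a c := K.isCluster_of_hasLabel ha rfl
    have hb := K.singleton_base_mem haK
    have hs := K.inner_mem haK hc
    have hle1 : (⟨_, hb⟩ : K.surgery) ≤ ⟨_, hs⟩ := Finset.singleton_subset_iff.2 (by simp)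
    have hle2 : (⟨_, ha⟩ : K.surgery) ≤ ⟨_, hs⟩ := Finset.singleton_subset_iff.2 (by simp)
    have h1 := ((hbase a hb).up hle1 (Subtype.ext (by simp [collapseFace, collapse]))).down hle2
      (Subtype.ext (by simp [collapseFace, collapse])) (D.surgered_ψ_surjective _
        (Subtype.ext (by simp [collapseFace, collapse])) (by
          intro x hx c' hl
          rw [Finset.mem_insert, Finset.mem_singleton] at hx
          rcases hx with rfl | rfl
          · exact hl.elim
          · exact ⟨_, by simp, hl⟩))
    rwa [← D.edgeElt_eq, ← D.edgeElt_eq, show D.vertexTransport (base a) = 1 from rfl,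
      one_mul] at h1
  cases x with
  | base a => exact hbase a hx
  | mid a c => exact hmid a c hx
  | copy a c =>
    obtain ⟨haK, hc⟩ : {a} ∈ K ∧ K.IsCluster a c := K.isCluster_of_hasLabel hx rfl
    have hs := K.outer_mem haK hc
    have hm : {mid a c} ∈ K.surgery := K.surgery.mem_of_subset hs (by simp) (by simp)
    have hle1 : (⟨_, hm⟩ : K.surgery) ≤ ⟨_, hs⟩ := Finset.singleton_subset_iff.2 (by simp)
    have hle2 : (⟨_, hx⟩ : K.surgery) ≤ ⟨_, hs⟩ := Finset.singleton_subset_iff.2 (by simp)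
    have h1 := ((hmid a c hm).up hle1 (Subtype.ext (by simp [collapseFace, collapse]))).down hle2
      (Subtype.ext (by simp [collapseFace, collapse])) (D.surgered_ψ_surjective _
        (Subtype.ext (by simp [collapseFace, collapse])) (by
          intro x hx c' hl
          rw [Finset.mem_insert, Finset.mem_singleton] at hx
          rcases hx with rfl | rfl
          · exact ⟨copy a c, by simp, hl⟩
          · exact ⟨copy a c, by simp, hl⟩))
    rwa [← D.edgeElt_eq, ← D.edgeElt_eq] at h1

theorem edgeElt_self (s : K.surgery) : D.edgeElt s.1 s.1 = 1 := by
  rw [D.edgeElt_eq le_rfl, MorphismTo.edge_refl]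

/-- The paths along the new segments to the vertices of a simplex that is collapsed to a vertex
agree in the simplex. -/
theorem exists_vertexTransport_mul_edgeElt_eq {s : K.surgery}
    (h : (K.collapseFace s).1.card ≤ 1) :
    ∃ g, ∀ x ∈ s.1, D.vertexTransport x * D.edgeElt {x} s.1 = g := by
  classical
  rcases K.eq_of_card_collapseFace_le_one h with ⟨y, hy⟩ | ⟨a, c, -, -, hs | hs⟩
  · refine ⟨D.vertexTransport y * D.edgeElt {y} s.1, fun x hx => ?_⟩
    rw [hy, Finset.mem_singleton] at hx
    rw [hx]
  · refine ⟨D.edgeElt {base a} s.1, fun x hx => ?_⟩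
    rw [hs, Finset.mem_insert, Finset.mem_singleton] at hx
    rcases hx with rfl | rfl
    · simp [vertexTransport]
    · simp [vertexTransport, hs]
  · refine ⟨D.vertexTransport (mid a c) * D.edgeElt {mid a c} s.1, fun x hx => ?_⟩
    rw [hs, Finset.mem_insert, Finset.mem_singleton] at hx
    rcases hx with rfl | rfl
    · rfl
    · simp [vertexTransport, hs]

theorem eq_of_le_of_two_le_card {t s : K.surgery} (h : t ≤ s)
    (he : K.collapseFace t = K.collapseFace s) (hs : 2 ≤ (K.collapseFace s).1.card) : t = s := by
  have h1 : K.liftFace he.le = K.liftFace (le_refl (K.collapseFace s)) :=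
    Subtype.ext (by simp only [liftFace, he])
  rw [← K.liftFace_collapseFace h hs he.le, h1, K.liftFace_collapseFace le_rfl hs le_rfl]

open scoped Classical in
/-- The transports along the new segments. -/
noncomputable def transportSystem : D.embedding.TransportSystem :=
  have hex : ∀ s : K.surgery, ∃ g, (2 ≤ (K.collapseFace s).1.card → g = 1) ∧
      ((K.collapseFace s).1.card ≤ 1 → ∀ x ∈ s.1,
        D.vertexTransport x * D.edgeElt {x} s.1 = g) := fun s => by
    by_cases h : (K.collapseFace s).1.card ≤ 1
    · obtain ⟨g, hg⟩ := D.exists_vertexTransport_mul_edgeElt_eq h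
      exact ⟨g, fun h' => by omega, fun _ => hg⟩
    · exact ⟨1, fun _ => rfl, fun h' => (h h').elim⟩
  { u := fun s => (hex s).choose
    isTransport := fun s => by
      by_cases h : (K.collapseFace s).1.card ≤ 1
      · obtain ⟨x, hx⟩ := s.2.1
        have hxK := K.surgery.singleton_mem_of_mem s.2 hx
        have hle : (⟨{x}, hxK⟩ : K.surgery) ≤ s := Finset.singleton_subset_iff.2 hx
        have h1 := (D.isTransport_vertexTransport hxK).up hle
          (K.eq_of_le_of_card_le_one (K.collapseFace_mono hle) h)
        rwa [← D.edgeElt_eq, (hex s).choose_spec.2 h x hx] at h1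
      · have h2 : 2 ≤ (K.collapseFace s).1.card := by omega
        rw [(hex s).choose_spec.1 h2]
        have h1 := EmbeddingOver.isTransport_section (E := D.embedding) (K.collapseFace s)
        rwa [show K.surgerySection.ι (K.collapseFace s) = s from
          K.liftFace_collapseFace le_rfl h2 le_rfl] at h1
    u_ι := fun σ => by
      have hf := K.surgerySection.map_ι σ
      by_cases h : σ.1.card ≤ 1
      · have hpos := (K.nonempty_of_mem σ.2).card_pos
        obtain ⟨a, ha⟩ := Finset.card_eq_one.1 (show σ.1.card = 1 by omega)
        obtain ⟨σ, hσ⟩ := σ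
        obtain rfl : σ = {a} := ha
        have h1 := K.surgerySection_ι_singleton hσ
        rw [← (hex _).choose_spec.2 (by rw [hf]; exact h) (base a) (by rw [h1]; simp), ← h1,
          edgeElt_self]
        exact one_mul _
      · exact (hex _).choose_spec.1 (by rw [hf]; omega)
    u_mul_edge := fun {t s} h he => by
      by_cases hs : (K.collapseFace s).1.card ≤ 1
      · obtain ⟨x, hx⟩ := t.2.1
        have hxK := K.surgery.singleton_mem_of_mem t.2 hx
        have hle : (⟨{x}, hxK⟩ : K.surgery) ≤ t := Finset.singleton_subset_iff.2 hx
        rw [← (hex t).choose_spec.2 (he ▸ hs) x hx, ← (hex s).choose_spec.2 hs x (h hx)]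
        have h1 := D.edgeElt_eq hle
        have h2 := D.edgeElt_eq (hle.trans h)
        dsimp only at h1 h2
        rw [h1, h2, mul_assoc, MorphismTo.edge_mul_edge_of_eq]
        exact EmbeddingOver.twist_eq_one D.embedding _ _
          (K.eq_of_le_of_card_le_one (K.collapseFace_mono hle) (he ▸ hs))
      · obtain rfl := eq_of_le_of_two_le_card h he (by omega)
        rw [MorphismTo.edge_refl, mul_one] }

end ComplexOfGroups.SurgeryData

/-! ### The graph on which the surgered complex is based -/

namespace PreAbstractSimplicialComplex

open SurgeryVertex

theorem reflTransGen_symm {V : Type u} {K : PreAbstractSimplicialComplex V} {a b : V}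
    (h : Relation.ReflTransGen (fun x y => ∃ s ∈ K, x ∈ s ∧ y ∈ s) a b) :
    Relation.ReflTransGen (fun x y => ∃ s ∈ K, x ∈ s ∧ y ∈ s) b a :=
  have : Std.Symm (fun x y => ∃ s ∈ K, x ∈ s ∧ y ∈ s) :=
    ⟨fun _ _ ⟨s, hs, hx, hy⟩ => ⟨s, hs, hy, hx⟩⟩
  Std.Symm.symm _ _ h

variable {V : Type u} (K : PreAbstractSimplicialComplex V)

theorem IsFinite.surgery {K : PreAbstractSimplicialComplex V} (hK : K.IsFinite) :
    K.surgery.IsFinite := by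
  classical
  have hv : {a : V | {a} ∈ K}.Finite :=
    Set.Finite.preimage (f := fun a : V => ({a} : Finset V))
      Finset.singleton_injective.injOn hK
  have hgen : {t | K.SurgeryGenerator t}.Finite := by
    refine Set.Finite.subset (((hK.image fun e => e.image base).union
      (hK.image fun σ => σ.image fun a => copy a (K.classAt σ a))).union
      (((hv.prod hK).image fun q => {base q.1, mid q.1 (K.edgeClass q.1 q.2)}).union
      ((hv.prod hK).image fun q =>
        {mid q.1 (K.edgeClass q.1 q.2), copy q.1 (K.edgeClass q.1 q.2)}))) ?_
    intro t ht
    cases ht with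
    | vertex a ha => exact Or.inl (Or.inl ⟨{a}, ha, by simp⟩)
    | edge e he _ _ => exact Or.inl (Or.inl ⟨e, he, rfl⟩)
    | thick σ hσ _ => exact Or.inl (Or.inr ⟨σ, hσ, rfl⟩)
    | inner a c ha hc =>
      obtain ⟨e, he, rfl, -⟩ := hc
      exact Or.inr (Or.inl ⟨(a, e), ⟨ha, he.1⟩, rfl⟩)
    | outer a c ha hc =>
      obtain ⟨e, he, rfl, -⟩ := hc
      exact Or.inr (Or.inr ⟨(a, e), ⟨ha, he.1⟩, rfl⟩)
  refine (hgen.biUnion fun t _ => t.powerset.finite_toSet).subset ?_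
  rintro s ⟨-, t, ht, hst⟩
  exact Set.mem_biUnion ht (Finset.mem_coe.2 (Finset.mem_powerset.2 hst))

theorem reflTransGen_base {x : SurgeryVertex V} (hx : {x} ∈ K.surgery) :
    Relation.ReflTransGen (fun x y => ∃ s ∈ K.surgery, x ∈ s ∧ y ∈ s) x (base x.collapse) := by
  classical
  cases x with
  | base a => exact .refl
  | mid a c =>
    obtain ⟨ha, hc⟩ := K.isCluster_of_hasLabel hx (c := c) rfl
    exact .single ⟨_, K.inner_mem ha hc, by simp [collapse], by simp⟩
  | copy a c =>
    obtain ⟨ha, hc⟩ := K.isCluster_of_hasLabel hx (c := c) rfl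
    exact .head ⟨_, K.outer_mem ha hc, by simp [collapse], Finset.mem_insert_self _ _⟩
      (.single ⟨_, K.inner_mem ha hc, by simp [collapse], by simp⟩)

theorem IsConnected.surgery {K : PreAbstractSimplicialComplex V} (hK : K.IsConnected) :
    K.surgery.IsConnected := by
  classical
  constructor
  · obtain ⟨s, hs⟩ := hK.1
    exact ⟨_, K.image_liftVertex_mem hs (K.nonempty_of_mem hs) subset_rfl⟩
  · have hstep : ∀ a b, Relation.ReflTransGen (fun x y => ∃ s ∈ K, x ∈ s ∧ y ∈ s) a b →
        Relation.ReflTransGen (fun x y => ∃ s ∈ K.surgery, x ∈ s ∧ y ∈ s) (base a) (base b) := by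
      intro a b h
      induction h with
      | refl => exact .refl
      | @tail b d _ h ih =>
        obtain ⟨s, hs, hb, hd⟩ := h
        have hs' := K.image_liftVertex_mem hs (K.nonempty_of_mem hs) subset_rfl
        have hb' := Finset.mem_image_of_mem (K.liftVertex s) hb
        have hd' := Finset.mem_image_of_mem (K.liftVertex s) hd
        have h1 := K.reflTransGen_base (K.surgery.singleton_mem_of_mem hs' hb')
        have h2 := K.reflTransGen_base (K.surgery.singleton_mem_of_mem hs' hd')
        rw [collapse_liftVertex] at h1 h2
        exact (ih.trans (reflTransGen_symm h1)).trans (.head ⟨_, hs', hb', hd'⟩ h2)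
    intro x y hx hy
    exact ((K.reflTransGen_base hx).trans (hstep _ _ (hK.2 _ _ (K.singleton_collapse_mem hx)
      (K.singleton_collapse_mem hy)))).trans (reflTransGen_symm (K.reflTransGen_base hy))

end PreAbstractSimplicialComplex

namespace SurgeryVertex

/-- The vertex `x` is one of the vertices `copy a c`. -/
def IsCopy {V : Type u} : SurgeryVertex V → Prop
  | base _ => False
  | mid _ _ => False
  | copy _ _ => True

end SurgeryVertex

namespace PreAbstractSimplicialComplex

open SurgeryVertex

variable {V : Type u} (K : PreAbstractSimplicialComplex V)

/-- Two vertices lie in a common simplex all of whose vertices are copies. -/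
def ThickAdj (x y : SurgeryVertex V) : Prop :=
  ∃ s ∈ K.surgery, (∀ z ∈ s, z.IsCopy) ∧ x ∈ s ∧ y ∈ s

/-- The vertices of the graph on which the complex obtained by surgery is based: the vertices
`base a` and `mid a c`, and the connected components of the subcomplex spanned by the copies. -/
def GraphVertex : Type u := Quot K.ThickAdj

/-- The projection to the vertices of the graph. -/
def graphProj (x : SurgeryVertex V) : K.GraphVertex := Quot.mk _ x

open scoped Classical in
/-- The graph obtained from the surgery by collapsing the components of the subcomplex spanned by
the copies to points. -/
noncomputable def surgeryGraph : PreAbstractSimplicialComplex K.GraphVertex :=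
  K.surgery.map K.graphProj

theorem graphProj_eq_iff {x y : SurgeryVertex V} :
    K.graphProj x = K.graphProj y ↔ Relation.ReflTransGen K.ThickAdj x y := by
  constructor
  · have hsymm : Std.Symm K.ThickAdj := ⟨fun _ _ ⟨s, hs, hc, hx, hy⟩ => ⟨s, hs, hc, hy, hx⟩⟩
    intro h
    replace h := Quot.eqvGen_exact h
    induction h with
    | rel _ _ h => exact .single h
    | refl => exact .refl
    | symm _ _ _ ih => exact Std.Symm.symm _ _ ih
    | trans _ _ _ _ _ ih₁ ih₂ => exact ih₁.trans ih₂
  · intro h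
    induction h with
    | refl => rfl
    | tail _ h ih => exact ih.trans (Quot.sound h)

/-- Only copies are identified in the graph. -/
theorem eq_of_graphProj_eq {x y : SurgeryVertex V} (h : K.graphProj x = K.graphProj y)
    (hx : ¬ x.IsCopy) : x = y := by
  rw [graphProj_eq_iff] at h
  induction h using Relation.ReflTransGen.head_induction_on with
  | refl => rfl
  | head h _ _ =>
    obtain ⟨s, -, hs, hx', -⟩ := h
    exact (hx (hs _ hx')).elim

theorem isCopy_of_graphProj_eq {x y : SurgeryVertex V} (h : K.graphProj x = K.graphProj y)
    (hne : x ≠ y) : x.IsCopy := by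
  by_contra hx
  exact hne (K.eq_of_graphProj_eq h hx)

theorem card_le_two_or_forall_isCopy {s : Finset (SurgeryVertex V)} (hs : s ∈ K.surgery) :
    s.card ≤ 2 ∨ ∀ x ∈ s, x.IsCopy := by
  classical
  obtain ⟨-, t, ht, hst⟩ := hs
  have hle := Finset.card_le_card hst
  cases ht with
  | vertex a ha => exact Or.inl (hle.trans (by simp))
  | edge e _ hcard _ => exact Or.inl (hle.trans (Finset.card_image_le.trans hcard.le))
  | inner a c _ _ => exact Or.inl (hle.trans Finset.card_le_two)
  | outer a c _ _ => exact Or.inl (hle.trans Finset.card_le_two)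
  | thick σ _ _ =>
    refine Or.inr fun x hx => ?_
    obtain ⟨a, -, rfl⟩ := Finset.mem_image.1 (hst hx)
    trivial

open scoped Classical in
/-- A simplex with both kinds of vertices is the outer half of a new segment. -/
theorem eq_outer {s : Finset (SurgeryVertex V)} (hs : s ∈ K.surgery) {x y : SurgeryVertex V}
    (hx : x ∈ s) (hy : y ∈ s) (hxc : x.IsCopy) (hyc : ¬ y.IsCopy) :
    ∃ a c, s = {mid a c, copy a c} := by
  obtain ⟨hne, t, ht, hst⟩ := hs
  have hxt := hst hx
  have hyt := hst hy
  cases ht with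
  | vertex a ha =>
    obtain rfl := Finset.mem_singleton.1 hxt
    exact hxc.elim
  | edge e _ hcard _ =>
    obtain ⟨a, -, rfl⟩ := Finset.mem_image.1 hxt
    exact hxc.elim
  | inner a c _ _ =>
    rw [Finset.mem_insert, Finset.mem_singleton] at hxt
    rcases hxt with rfl | rfl <;> exact hxc.elim
  | outer a c _ _ =>
    refine ⟨a, c, (Finset.eq_singleton_or_eq_of_subset_pair hne hst).resolve_left ?_⟩
    rintro ⟨z, rfl⟩
    rw [Finset.mem_singleton] at hx hy
    subst hx hy
    exact hyc hxc
  | thick σ _ _ =>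
    obtain ⟨a, -, rfl⟩ := Finset.mem_image.1 hyt
    exact (hyc trivial).elim

open scoped Classical in
theorem card_image_graphProj_of_forall_isCopy {s : Finset (SurgeryVertex V)} (hs : s ∈ K.surgery)
    (hc : ∀ x ∈ s, x.IsCopy) : (s.image K.graphProj).card ≤ 1 := by
  rw [Finset.card_le_one]
  intro a ha b hb
  obtain ⟨x, hx, rfl⟩ := Finset.mem_image.1 ha
  obtain ⟨y, hy, rfl⟩ := Finset.mem_image.1 hb
  exact Quot.sound ⟨s, hs, hc, hx, hy⟩

theorem exists_of_singleton_mem_surgeryGraph {y : K.GraphVertex} (hy : {y} ∈ K.surgeryGraph) :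
    ∃ x, {x} ∈ K.surgery ∧ K.graphProj x = y := by
  classical
  obtain ⟨s, hs, hsy⟩ := hy
  obtain ⟨x, hx⟩ := K.surgery.nonempty_of_mem hs
  refine ⟨x, K.surgery.singleton_mem_of_mem hs hx, ?_⟩
  have := Finset.mem_image_of_mem K.graphProj hx
  rw [show s.image K.graphProj = {y} from hsy] at this
  exact Finset.mem_singleton.1 this

theorem fiber_graphProj_isConnected {y : K.GraphVertex} (hy : {y} ∈ K.surgeryGraph) :
    (K.surgery.fiber K.graphProj y).IsConnected := by
  obtain ⟨x, hx, rfl⟩ := K.exists_of_singleton_mem_surgeryGraph hy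
  refine ⟨⟨{x}, hx, by simp⟩, ?_⟩
  rintro a b ⟨-, ha⟩ ⟨-, hb⟩
  replace ha := ha a (by simp)
  replace hb := hb b (by simp)
  have hab := K.graphProj_eq_iff.1 (ha.trans hb.symm)
  induction hab using Relation.ReflTransGen.head_induction_on with
  | refl => exact .refl
  | head h _ ih =>
    obtain ⟨s, hs, hc, h1, h2⟩ := h
    have hall : ∀ z ∈ s, K.graphProj z = K.graphProj x := fun z hz =>
      (show K.graphProj z = _ from Quot.sound ⟨s, hs, hc, hz, h1⟩).trans ha
    exact .head ⟨s, ⟨hs, hall⟩, h1, h2⟩ (ih (hall _ h2))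

theorem card_le_two_of_mem_surgeryGraph {e : Finset K.GraphVertex} (he : e ∈ K.surgeryGraph) :
    e.card ≤ 2 := by
  classical
  obtain ⟨s, hs, rfl⟩ := he
  rcases K.card_le_two_or_forall_isCopy hs with h | h
  · exact Finset.card_image_le.trans h
  · exact (K.card_image_graphProj_of_forall_isCopy hs h).trans one_le_two

theorem surgeryGraph_edge_bijection {e : Finset K.GraphVertex} (he : e ∈ K.surgeryGraph)
    (hcard : e.card = 2) : ∃! s : Finset (SurgeryVertex V), s ∈ K.surgery ∧ s.card = 2 ∧
      K.graphProj '' (s : Set (SurgeryVertex V)) = (e : Set K.GraphVertex) := by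
  classical
  obtain ⟨s, hs, hse⟩ := he
  dsimp only at hse
  have hnc : ∀ s ∈ K.surgery, s.image K.graphProj = e → ∃ x ∈ s, ¬ x.IsCopy := by
    intro s hs hse
    by_contra! h
    have := K.card_image_graphProj_of_forall_isCopy hs h
    rw [hse] at this
    omega
  have hsub : ∀ s ∈ K.surgery, ∀ s' : Finset (SurgeryVertex V),
      s.image K.graphProj = e → s'.image K.graphProj = e →
      ∀ x ∈ s, ¬ x.IsCopy → x ∈ s' := by
    intro s hs s' hse hse' x hx hxc
    have := Finset.mem_image_of_mem K.graphProj hx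
    rw [hse, ← hse'] at this
    obtain ⟨y, hy, hyx⟩ := Finset.mem_image.1 this
    rwa [K.eq_of_graphProj_eq hyx.symm hxc]
  have hs2 : s.card = 2 := by
    refine le_antisymm ((K.card_le_two_or_forall_isCopy hs).resolve_right fun h => ?_) ?_
    · obtain ⟨x, hx, hxc⟩ := hnc s hs hse
      exact hxc (h x hx)
    · rw [← hcard, ← hse]
      exact Finset.card_image_le
  refine ⟨s, ⟨hs, hs2, by rw [← hse, Finset.coe_image]⟩, ?_⟩
  rintro s' ⟨hs', hs2', hse'⟩
  replace hse' : s'.image K.graphProj = e := by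
    rw [← Finset.coe_inj, Finset.coe_image, hse']
  by_cases h : ∃ x ∈ s, x.IsCopy
  · by_cases h' : ∃ x ∈ s', x.IsCopy
    · obtain ⟨x, hx, hxc⟩ := h
      obtain ⟨y, hy, hyc⟩ := hnc s hs hse
      obtain ⟨x', hx', hxc'⟩ := h'
      obtain ⟨y', hy', hyc'⟩ := hnc s' hs' hse'
      obtain ⟨a, c, rfl⟩ := K.eq_outer hs hx hy hxc hyc
      obtain ⟨a', c', rfl⟩ := K.eq_outer hs' hx' hy' hxc' hyc'
      have := hsub _ hs _ hse hse' (mid a c) (by simp) id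
      simp only [Finset.mem_insert, Finset.mem_singleton, reduceCtorEq, or_false,
        mid.injEq] at this
      rw [this.1, this.2]
    · push Not at h'
      exact Finset.eq_of_subset_of_card_le
        (fun x hx => hsub s' hs' s hse' hse x hx (h' x hx)) (by omega)
  · push Not at h
    exact (Finset.eq_of_subset_of_card_le
      (fun x hx => hsub s hs s' hse hse' x hx (h x hx)) (by omega)).symm

theorem IsFinite.surgeryGraph {K : PreAbstractSimplicialComplex V} (hK : K.IsFinite) :
    K.surgeryGraph.IsFinite :=
  hK.surgery.image _

theorem IsConnected.surgeryGraph {K : PreAbstractSimplicialComplex V} (hK : K.IsConnected) :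
    K.surgeryGraph.IsConnected := by
  classical
  refine ⟨hK.surgery.1.image _, ?_⟩
  intro a b ha hb
  obtain ⟨x, hx, rfl⟩ := K.exists_of_singleton_mem_surgeryGraph ha
  obtain ⟨y, hy, rfl⟩ := K.exists_of_singleton_mem_surgeryGraph hb
  refine (hK.surgery.2 x y hx hy).lift K.graphProj ?_
  rintro z w ⟨s, hs, hz, hw⟩
  exact ⟨s.image K.graphProj, ⟨s, hs, rfl⟩, Finset.mem_image_of_mem _ hz,
    Finset.mem_image_of_mem _ hw⟩

theorem surgery_isSimplicial : K.surgery.IsSimplicial K.surgeryGraph K.graphProj := by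
  classical
  exact fun s hs => ⟨s.image K.graphProj, ⟨s, hs, rfl⟩, Finset.coe_image⟩

/-- A simplex of positive dimension in a fibre of the projection to the graph consists of
copies. -/
theorem forall_isCopy_of_mem_fiber {s : Finset (SurgeryVertex V)} {y : K.GraphVertex}
    (hs : s ∈ K.surgery.fiber K.graphProj y) (hcard : 1 < s.card) : ∀ x ∈ s, x.IsCopy := by
  intro x hx
  obtain ⟨z, hz, hzx⟩ := Finset.exists_mem_ne hcard x
  exact K.isCopy_of_graphProj_eq ((hs.2 x hx).trans (hs.2 z hz).symm) hzx.symm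

/-- A simplex of positive dimension that consists of copies comes from a simplex of `K` of dimension
at least two. -/
theorem exists_thick_of_forall_isCopy {s : Finset (SurgeryVertex V)} (hs : s ∈ K.surgery)
    (hcard : 1 < s.card) (hc : ∀ x ∈ s, x.IsCopy) :
    ∃ σ ∈ K, 3 ≤ σ.card ∧
      ∀ x ∈ s, x.collapse ∈ σ ∧ x = copy x.collapse (K.classAt σ x.collapse) := by
  classical
  obtain ⟨hne, t, ht, hst⟩ := hs
  cases ht with
  | vertex a ha => exact ((Finset.card_le_card hst).not_gt (by simpa using hcard)).elim
  | edge e _ _ _ =>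
    obtain ⟨x, hx⟩ := hne
    have := hc x hx
    obtain ⟨a, -, rfl⟩ := Finset.mem_image.1 (hst hx)
    exact this.elim
  | inner a c _ _ =>
    obtain ⟨x, hx⟩ := hne
    have := hc x hx
    have hx' := hst hx
    rw [Finset.mem_insert, Finset.mem_singleton] at hx'
    rcases hx' with rfl | rfl <;> exact this.elim
  | outer a c _ _ =>
    refine (hcard.not_ge (Finset.card_le_one.2 fun x hx y hy => ?_)).elim
    have : ∀ z ∈ s, z = copy a c := by
      intro z hz
      have h1 := hst hz
      rw [Finset.mem_insert, Finset.mem_singleton] at h1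
      rcases h1 with rfl | rfl
      · exact (hc _ hz).elim
      · rfl
    rw [this x hx, this y hy]
  | thick σ hσ hcardσ =>
    refine ⟨σ, hσ, hcardσ, fun x hx => ?_⟩
    obtain ⟨a, ha, rfl⟩ := Finset.mem_image.1 (hst hx)
    exact ⟨ha, rfl⟩

theorem mem_clusterFaces_classAt {σ τ : Finset V} {a : V} (hσ : σ ∈ K) (hcard : 2 ≤ σ.card)
    (ha : a ∈ σ) (hτ : τ ∈ K) (h : τ ⊆ σ) : τ ∈ K.clusterFaces (K.classAt σ a) := by
  obtain ⟨e, he, heσ⟩ := K.exists_isEdgeAt_subset hσ ha hcard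
  exact ⟨hτ, σ, hσ, h, e, ⟨e, he, heσ, .refl⟩, heσ⟩

end PreAbstractSimplicialComplex

/-! ### Finiteness properties of the surgered complex -/

theorem Group.fg_of_subgroup_fg_of_finiteIndex {G : Type*} [Group G] (A : Subgroup G)
    [A.FiniteIndex] [hA : Group.FG A] : Group.FG G := by
  rw [Group.fg_iff_subgroup_fg, Subgroup.fg_iff] at hA
  obtain ⟨S, hS, hfin⟩ := hA
  rw [Group.fg_iff]
  have hq : Finite (G ⧸ A) := inferInstance
  refine ⟨S ∪ Set.range fun q : G ⧸ A => Quotient.out q, ?_,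
    hfin.union (@Set.finite_range _ _ _ hq)⟩
  rw [eq_top_iff]
  intro g _
  have h1 : (Quotient.out (g : G ⧸ A))⁻¹ * g ∈ A := by
    rw [← QuotientGroup.eq, QuotientGroup.out_eq']
  have h2 : A ≤ Subgroup.closure (S ∪ Set.range fun q : G ⧸ A => Quotient.out q) := by
    rw [← hS]
    exact Subgroup.closure_mono Set.subset_union_left
  have h3 := mul_mem (Subgroup.subset_closure (Or.inr ⟨(g : G ⧸ A), rfl⟩) :
    Quotient.out (g : G ⧸ A) ∈ Subgroup.closure (S ∪ Set.range fun q : G ⧸ A => Quotient.out q))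
    (h2 h1)
  rwa [mul_inv_cancel_left] at h3

theorem Subgroup.fg_of_le_of_isFiniteRelIndex {G : Type*} [Group G] {A B : Subgroup G} (h : A ≤ B)
    [A.IsFiniteRelIndex B] [Group.FG A] : Group.FG B :=
  have : Group.FG (A.subgroupOf B) :=
    Group.fg_of_surjective (f := (Subgroup.subgroupOfEquivOfLe h).symm.toMonoidHom)
      (Subgroup.subgroupOfEquivOfLe h).symm.surjective
  Group.fg_of_subgroup_fg_of_finiteIndex (A.subgroupOf B)

namespace PreAbstractSimplicialComplex.IsConnected

/-- A complex of groups over a connected complex has paths between any two simplices. -/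
theorem exists_isPath {V : Type u} {K : PreAbstractSimplicialComplex V} (hK : K.IsConnected)
    (𝒢 : ComplexOfGroups.{u, v} K) (s t : K) : ∃ x, 𝒢.IsPath s t x := by
  have hface : ∀ {a : V} {s : K} (ha : a ∈ s.1) (haK : {a} ∈ K), 𝒢.IsPath ⟨{a}, haK⟩ s
      (𝒢.univ.edge (show (⟨{a}, haK⟩ : K) ≤ s from Finset.singleton_subset_iff.2 ha)) :=
    fun ha haK => ComplexOfGroups.isPath_edge _
  obtain ⟨a, ha⟩ := K.nonempty_of_mem s.2
  obtain ⟨b, hb⟩ := K.nonempty_of_mem t.2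
  have haK := K.singleton_mem_of_mem s.2 ha
  have hbK := K.singleton_mem_of_mem t.2 hb
  have hab : ∀ hbK : {b} ∈ K, ∃ x, 𝒢.IsPath ⟨{a}, haK⟩ ⟨{b}, hbK⟩ x := by
    have h := hK.2 a b haK hbK
    clear hbK hb
    induction h with
    | refl => exact fun _ => ⟨1, ComplexOfGroups.isPath_one _⟩
    | tail _ h ih =>
      obtain ⟨r, hr, h1, h2⟩ := h
      intro hcK
      have h1K := K.singleton_mem_of_mem hr h1
      obtain ⟨x, hx⟩ := ih h1K
      exact ⟨_, hx.mul ((hface (s := ⟨r, hr⟩) h1 h1K).mul (hface (s := ⟨r, hr⟩) h2 hcK).inv)⟩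
  obtain ⟨x, hx⟩ := hab hbK
  exact ⟨_, ((hface ha haK).inv.mul hx).mul (hface hb hbK)⟩

end PreAbstractSimplicialComplex.IsConnected

namespace ComplexOfGroups

open PreAbstractSimplicialComplex SurgeryVertex

variable {V : Type u} {K : PreAbstractSimplicialComplex V} {𝒢 : ComplexOfGroups.{u, v} K}

open scoped Classical in
theorem WeakQICondition.nonempty_surgeryData (h : 𝒢.WeakQICondition) :
    Nonempty 𝒢.SurgeryData :=
  ⟨{ H := fun ρ c => if h : ∃ H, 𝒢.IsClusterSubgroup ρ c H then h.choose else ⊤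
     spec := fun a ha c hc => by
      rw [dif_pos (h.exists_subgroup a ha c hc)]
      exact (h.exists_subgroup a ha c hc).choose_spec }⟩

open scoped Pointwise in
/-- The image of the group of any simplex of the cluster has finite index in the cluster
subgroup: up to conjugation by a twisting element, the local homomorphism factors through the group
of an edge in the cluster. -/
theorem IsClusterSubgroup.isFiniteRelIndex {ρ e σ : K} {c : Set (Finset V)}
    {H : Subgroup (𝒢.G ρ)} (hH : 𝒢.IsClusterSubgroup ρ c H) (h₁ : ρ < e) (h₂ : e ≤ σ)
    (he : e.1 ∈ c) (hσ : σ.1 ∈ K.clusterFaces c)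
    (hfin : e < σ → (𝒢.ψ h₂).range.FiniteIndex) :
    (𝒢.ψ (h₁.le.trans h₂)).range.IsFiniteRelIndex H := by
  rcases h₂.eq_or_lt with rfl | hlt
  · exact Subgroup.isFiniteRelIndex_iff_finiteIndex.2 (hH.finiteIndex _ he)
  · have h3 : (𝒢.ψ h₁.le).range.relIndex H ≠ 0 :=
      (Subgroup.isFiniteRelIndex_iff_finiteIndex.2 (hH.finiteIndex h₁.le he)).relIndex_ne_zero
    have h4 : ((𝒢.ψ h₂).range.map (𝒢.ψ h₁.le)).relIndex (𝒢.ψ h₁.le).range ≠ 0 := by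
      rw [MonoidHom.range_eq_map (𝒢.ψ h₁.le),
        Subgroup.relIndex_map_map_of_injective _ _ (𝒢.ψ_injective _), Subgroup.relIndex_top_right]
      exact (hfin hlt).index_ne_zero
    have h5 := Subgroup.relIndex_ne_zero_trans h4 h3
    have htw := hH.twist_mem h₁ hlt hσ
    have h6 : MulAut.conj (𝒢.twist h₁.le h₂) • (𝒢.ψ (h₁.le.trans h₂)).range =
        (𝒢.ψ h₂).range.map (𝒢.ψ h₁.le) := by
      ext g
      rw [Subgroup.mem_smul_pointwise_iff_exists]
      constructor
      · rintro ⟨_, ⟨x, rfl⟩, rfl⟩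
        exact ⟨_, ⟨x, rfl⟩, (𝒢.ψ_comp h₁.le h₂ x).symm⟩
      · rintro ⟨_, ⟨x, rfl⟩, rfl⟩
        exact ⟨_, ⟨x, rfl⟩, 𝒢.ψ_comp h₁.le h₂ x⟩
    rw [← h6, ← Subgroup.conj_smul_eq_self_of_mem htw, Subgroup.relIndex_pointwise_smul] at h5
    exact ⟨h5⟩

namespace SurgeryData

variable (D : 𝒢.SurgeryData)

theorem finiteIndex_range_surgered_ψ {t s : K.surgery} (h : t ≤ s) (hs : D.localGroup s = ⊤)
    (hfin : (𝒢.ψ (K.collapseFace_mono h)).range.IsFiniteRelIndex (D.localGroup t)) :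
    (D.surgered.ψ h).range.FiniteIndex := by
  have h1 : ((𝒢.ψ (K.collapseFace_mono h)).range.subgroupOf (D.localGroup t)).FiniteIndex :=
    Subgroup.isFiniteRelIndex_iff_finiteIndex.1 hfin
  refine Subgroup.finiteIndex_of_le
    (H := (𝒢.ψ (K.collapseFace_mono h)).range.subgroupOf (D.localGroup t)) ?_
  rintro ⟨x, hx⟩ ⟨y, hy⟩
  exact ⟨⟨y, by rw [hs]; exact Subgroup.mem_top y⟩, Subtype.ext hy⟩

/-- The surgered complex satisfies the qi condition on the simplices that consist of copies. -/
theorem finiteIndex_range_of_forall_isCopy (hweak : 𝒢.WeakQICondition) {t s : K.surgery}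
    (h : t < s) (hc : ∀ x ∈ s.1, x.IsCopy) : (D.surgered.ψ h.le).range.FiniteIndex := by
  classical
  have hcard : 1 < s.1.card := by
    have h1 : t.1.card < s.1.card := Finset.card_lt_card h
    have h2 := (K.surgery.nonempty_of_mem t.2).card_pos
    omega
  obtain ⟨σ, hσ, hσcard, hsσ⟩ := K.exists_thick_of_forall_isCopy s.2 hcard hc
  have hfs : 2 ≤ (K.collapseFace s).1.card := by
    have : (K.collapseFace s).1.card = s.1.card := by
      refine Finset.card_image_of_injOn fun x hx y hy hxy => ?_
      rw [(hsσ x hx).2, (hsσ y hy).2, hxy]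
    omega
  have hsub : (K.collapseFace s).1 ⊆ σ := by
    intro a ha
    obtain ⟨x, hx, rfl⟩ := Finset.mem_image.1 ha
    exact (hsσ x hx).1
  have hlt : K.collapseFace t < K.collapseFace s :=
    lt_of_le_of_ne (K.collapseFace_mono h.le) fun he => h.ne (eq_of_le_of_two_le_card h.le he hfs)
  obtain ⟨x, hx⟩ := t.2.1
  have hxσ := hsσ x (h.le hx)
  have hcl := K.isCluster_classAt hσ hσcard hxσ.1
  have hmem := K.mem_clusterFaces_classAt hσ (by omega) hxσ.1 (K.collapseFace s).2 hsub
  have hxt := K.collapse_mem_collapseFace hx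
  refine D.finiteIndex_range_surgered_ψ h.le (D.localGroup_eq_top_of_two_le_card hfs) ?_
  by_cases ht : 2 ≤ (K.collapseFace t).1.card
  · have := hweak.finiteIndex _ _ hcl hlt ht hmem
    exact Subgroup.isFiniteRelIndex_of_finiteIndex
  · have hpos := (K.nonempty_of_mem (K.collapseFace t).2).card_pos
    have hft : (K.collapseFace t).1 = {x.collapse} :=
      (Finset.eq_of_subset_of_card_le (Finset.singleton_subset_iff.2 hxt)
        (by rw [Finset.card_singleton]; omega)).symm
    have hxK := K.singleton_mem_of_mem hσ hxσ.1
    have hft' : K.collapseFace t = ⟨{x.collapse}, hxK⟩ := Subtype.ext hft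
    have hspec := D.spec _ hxK _ hcl
    rw [← hft'] at hspec
    obtain ⟨e, he, hes⟩ := K.exists_isEdgeAt_subset (K.collapseFace s).2
      (K.collapseFace_mono h.le hxt) hfs
    have hec : e ∈ K.classAt σ x.collapse := ⟨e, he, hes.trans hsub, .refl⟩
    have hte : K.collapseFace t < ⟨e, he.1⟩ := by
      refine lt_of_le_of_ne ?_ ?_
      · change (K.collapseFace t).1 ⊆ e
        rw [hft]
        exact Finset.singleton_subset_iff.2 he.2.2
      · intro h'
        have h1 := he.2.1
        rw [show (K.collapseFace t).1 = e from congrArg Subtype.val h'] at ht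
        omega
    have := hspec.isFiniteRelIndex (e := ⟨e, he.1⟩) (σ := K.collapseFace s) hte hes hec hmem
      fun hlt' => hweak.finiteIndex _ _ hcl hlt' he.2.1.ge hmem
    refine Subgroup.isFiniteRelIndex_of_le_right
      (L := D.H (K.collapseFace t) (K.classAt σ x.collapse)) _ ?_
    intro g hg
    refine (D.mem_localGroup.1 hg) x _ hx ?_ hft
    rw [hxσ.2]
    rfl

/-- The local groups of the surgered complex are local groups of the given complex or overgroups
of finite index of images of such. -/
theorem fg_surgered (hfg : ∀ σ, Group.FG (𝒢.G σ)) (s : K.surgery) :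
    Group.FG (D.surgered.G s) := by
  classical
  change Group.FG (D.localGroup s)
  by_cases hl : ∃ x ∈ s.1, (K.collapseFace s).1 = {x.collapse} ∧ ∃ c, x.HasLabel c
  · obtain ⟨x, hx, hs, c, hxc⟩ := hl
    obtain ⟨hxK, hcl⟩ := K.isCluster_of_hasLabel (K.surgery.singleton_mem_of_mem s.2 hx) hxc
    have huniq : ∀ y ∈ s.1, ∀ c', y.HasLabel c' → c' = c := by
      intro y hy c' hyc
      rcases K.eq_of_card_collapseFace_le_one (s := s) (by simp [hs]) with
        ⟨z, hz⟩ | ⟨a, d, -, -, hz | hz⟩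
      · rw [hz, Finset.mem_singleton] at hx hy
        subst hx hy
        cases y with
        | base a => exact hyc.elim
        | mid a d => exact hyc.symm.trans hxc
        | copy a d => exact hyc.symm.trans hxc
      · rw [hz, Finset.mem_insert, Finset.mem_singleton] at hx hy
        rcases hx with rfl | rfl
        · exact hxc.elim
        rcases hy with rfl | rfl
        · exact hyc.elim
        · exact hyc.symm.trans hxc
      · rw [hz, Finset.mem_insert, Finset.mem_singleton] at hx hy
        rcases hx with rfl | rfl <;> rcases hy with rfl | rfl <;> exact hyc.symm.trans hxc
    have hgroup : D.localGroup s = D.H (K.collapseFace s) c := by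
      ext g
      rw [mem_localGroup]
      refine ⟨fun h => h x c hx hxc hs, fun h y c' hy hyc _ => ?_⟩
      rw [huniq y hy c' hyc]
      exact h
    have hs' : K.collapseFace s = ⟨{x.collapse}, hxK⟩ := Subtype.ext hs
    have hspec := D.spec _ hxK c hcl
    rw [← hs'] at hspec
    rw [hgroup]
    obtain ⟨e, he, rfl, -⟩ := hcl
    have hle : K.collapseFace s ≤ ⟨e, he.1⟩ := by
      rw [hs']
      exact Finset.singleton_subset_iff.2 he.2.2
    have hec : e ∈ K.edgeClass x.collapse e := Relation.ReflTransGen.refl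
    have h1 := hspec.range_le hle hec
    have := Subgroup.isFiniteRelIndex_iff_finiteIndex.2 (hspec.finiteIndex hle hec)
    have := hfg ⟨e, he.1⟩
    have := Group.fg_range (𝒢.ψ hle)
    exact Subgroup.fg_of_le_of_isFiniteRelIndex h1
  · push Not at hl
    rw [D.localGroup_eq_top hl, Group.fg_iff_subgroup_fg, ← Group.fg_def]
    exact hfg _

theorem nonempty_π₁_mulEquiv_surgered (hK : K.IsConnected) (σ : K) (s : K.surgery) :
    Nonempty (𝒢.π₁ σ ≃* D.surgered.π₁ s) := by
  obtain ⟨φ⟩ := D.transportSystem.nonempty_π₁_mulEquiv σ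
  obtain ⟨x, hx⟩ := hK.surgery.exists_isPath D.surgered (K.surgerySection.ι σ) s
  obtain ⟨χ⟩ := nonempty_π₁_mulEquiv_of_isPath hx
  exact ⟨φ.trans χ⟩

theorem isBasedOnGraphQI_surgered (hfin : K.IsFinite) (hconn : K.IsConnected)
    (hdev : D.surgered.Developable) (hweak : 𝒢.WeakQICondition) :
    D.surgered.IsBasedOnGraphQI K.surgeryGraph K.graphProj where
  isFinite_total := hfin.surgery
  isConnected_total := hconn.surgery
  isFinite_base := hfin.surgeryGraph
  isConnected_base := hconn.surgeryGraph
  dim_base _ he := K.card_le_two_of_mem_surgeryGraph he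
  isSimplicial := K.surgery_isSimplicial
  fiber_connected _ hy := K.fiber_graphProj_isConnected hy
  fiber_developable _ _ := hdev.pullback _ _
  edge_bijection _ he hcard := K.surgeryGraph_edge_bijection he hcard
  fiber_qi _ hy :=
    { isFinite := hfin.surgery.subset fun _ hs => hs.1
      isConnected := K.fiber_graphProj_isConnected hy
      developable := hdev.pullback _ _
      finiteIndex := fun {τ σ} h => by
        have hpos := (K.surgery.nonempty_of_mem τ.2.1).card_pos
        have hlt : τ.1.card < σ.1.card := Finset.card_lt_card h
        exact D.finiteIndex_range_of_forall_isCopy hweak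
          (t := ⟨τ.1, τ.2.1⟩) (s := ⟨σ.1, σ.2.1⟩) h
          (K.forall_isCopy_of_mem_fiber σ.2 (lt_of_le_of_lt hpos hlt)) }

end SurgeryData

end ComplexOfGroups

theorem mainTheorem7 {V : Type u} (K : PreAbstractSimplicialComplex V)
    (hfin : K.IsFinite) (hconn : K.IsConnected)
    (𝒢 : ComplexOfGroups.{u, v} K) (hfg : ∀ σ, Group.FG (𝒢.G σ))
    (hdev : 𝒢.Developable) (hweak : 𝒢.WeakQICondition) :
    ∃ (D : 𝒢.SurgeryData) (W : Type u) (Y : PreAbstractSimplicialComplex W)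
      (p : SurgeryVertex V → W),
      D.surgered.IsBasedOnGraphQI Y p ∧
      D.surgered.Developable ∧
      (∀ σ, Group.FG (D.surgered.G σ)) ∧
      ∀ (σ : K) (σ' : K.surgery), Nonempty (𝒢.π₁ σ ≃* D.surgered.π₁ σ') := by
  obtain ⟨D⟩ := hweak.nonempty_surgeryData
  have hdev' : D.surgered.Developable :=
    (hdev.pullback K.collapseFace K.collapseFace_mono).sub _ _ _
  exact ⟨D, _, K.surgeryGraph, K.graphProj, D.isBasedOnGraphQI_surgered hfin hconn hdev' hweak,
    hdev', D.fg_surgered hfg, D.nonempty_π₁_mulEquiv_surgered hconn⟩
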